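/- Fix integers $d,r\ge 1$, a set $\mathcal S\subset\mathbb R^2$, loading functions $a=(a_1,\dots,a_d)':\mathcal S\to\mathbb R^d$ and a centered $d\times r$ matrix-valued process $X=(X_t)_{t\in\mathbb Z}$. For $N\in\mathbb N$ let $p=p_N$, $T=T_N$ be integers, $B$ a $p\times r$ matrix, and $\mathcal S_1,\mathcal S_2\subset\mathcal S$ disjoint finite sets of $n_1,n_2\ge d$ sites; put $n=n_1+n_2$ and let $n,p,T\to\infty$ as $N\to\infty$. For $t=1,\dots,T$ and $s\in\mathcal S_1\cup\mathcal S_2$ one observes $$y_t(s)=BX_t'a(s)+\varepsilon_t(s)\in\mathbb R^p ,$$ equivalently $Y_{lt}=A_lX_tB'+E_{lt}$, $l=1,2$, where $Y_{lt}$, $A_l$, $E_{lt}$ have the rows $y_t(s)'$, $a(s)'$, $\varepsilon_t(s)'$, $s\in\mathcal S_l$. Noise: $\varepsilon_t(s)$ is square integrable with mean zero; $\mathrm{Cov}(\varepsilon_t(u),\varepsilon_t(v))=0$ for $u\neq v$; the fields $\varepsilon_t$, $t\in\mathbb Z$, are independent of each other and of $X$; and there is a constant $K$, not depending on $N$, $t$,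 the sites or the coordinates, with $E\,\varepsilon_{t,i}(u)^2\le K$ for all sampled $u$, and $E[\varepsilon_{t,i}(u)^2\varepsilon_{t,j}(v)^2]\le K$ for $u\in\mathcal S_1$, $v\in\mathcal S_2$. Let $\Omega_{ij}=\mathrm{Cov}(Y_{1t,\cdot i},Y_{2t,\cdot j})$, $M_{1}=\sum_{i,j=1}^p\Omega_{ij}\Omega_{ij}'$, $M_{2}=\sum_{i,j=1}^p\Omega_{ij}'\Omega_{ij}$ (these do not depend on $t$). Identification: for all large $N$, $M_1$ and $M_2$ have rank $d$, i.e. $d$ positive eigenvalues. Write $\|A\|_2^2=\lambda_{\max}(A'A)$, let $\|A\|_{\min}^2$ be the smallest eigenvalue of $A'A$ or $AA'$, whichever is the smaller matrix, and $a_N\asymp b_N$ if $a_N=O(b_N)$ and $b_N=O(a_N)$. Assume: 1. $(X_t)$ is strictly stationary and $\alpha$-mixing, with $\sum_{h\ge1}\alpha(h)^{1-2/q}<\infty$ for some $q>2$, where $\alpha(h)=\sup_\tau\sup|P(F\cap G)-P(F)P(G)|$, the inner supremum being over $F\in\sigma(X_t:t\le\tau)$, $G\in\sigma(X_t:t\ge\tau+h)$.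 2. $E|X_{t,ij}|^{2q}\le C$ for all $t,i,j$. Moreover there is a lag $h\ge1$ such that the $\max(d,r)$-th largest singular value of $\Sigma_f(h)=\mathrm{Cov}(\mathrm{vec}\,X_t,\mathrm{vec}\,X_{t+h})$ is positive (equivalently, $\mathrm{rank}\,\Sigma_f(h)\ge\max(d,r)$), and $\mathrm{Cov}(X_{t,i\cdot},X_{t+h,i\cdot})\ne0$, $\mathrm{Cov}(X_{t,\cdot j},X_{t+h,\cdot j})\neq0$ for every row $i$ and every column $j$. 3. For a constant $\delta\in[0,1]$: $\|A_l\|_{\min}^2\asymp n_l^{1-\delta}\asymp\|A_l\|_2^2$, $l=1,2$. 4. For a constant $\gamma\in[0,1]$: $\|B\|_{\min}^2\asymp p^{1-\gamma}\asymp\|B\|_2^2$. Let $\hat\Omega_{ij}=T^{-1}\sum_{t=1}^TY_{1t,\cdot i}Y_{2t,\cdot j}'$, $\hat M_1=\sum_{i,j}\hat\Omega_{ij}\hat\Omega_{ij}'$, $\hat M_2=\sum_{i,j}\hat\Omega_{ij}'\hat\Omega_{ij}$, and let $\hat A_l$ be any $n_l\times d$ matrix with orthonormal columns whose $j$-th column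 is an eigenvector of $\hat M_l$ for its $j$-th largest eigenvalue. For $n_l\times d$ matrices $U,V$ of rank $d$ let $$\mathcal D(\mathcal M(U),\mathcal M(V))=\Bigl(1-\tfrac1d\,\mathrm{tr}\bigl(U(U'U)^{-1}U'\,V(V'V)^{-1}V'\bigr)\Bigr)^{1/2}$$ be the distance of their column spaces. If $n^\delta p^\gamma T^{-1/2}=o(1)$, then for $l=1,2$ $$\mathcal D(\mathcal M(\hat A_l),\mathcal M(A_l))=O_p\Bigl(\bigl((n_1n_2^{\delta-1}p^\gamma+n_1^{\delta-1}n_2p^\gamma+n_1^\delta n_2^\delta p^{2\gamma})T^{-1}\bigr)^{1/2}\Bigr).$$ If in addition $n_1\asymp n_2\asymp n$, then for $l=1,2$ $$\mathcal D(\mathcal M(\hat A_l),\mathcal M(A_l))=O_p\bigl(n^\delta p^\gamma T^{-1/2}\bigr).$$ -/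

import Mathlib

open MeasureTheory ProbabilityTheory Filter Asymptotics
open scoped Matrix Topology

noncomputable section

namespace SpatialFactor

/-! ### Matrix notions -/

/-- The real eigenvalues of a square matrix. -/
def eigenvalueSet {ι : Type*} [Fintype ι] (M : Matrix ι ι ℝ) : Set ℝ :=
  {c | ∃ v : ι → ℝ, v ≠ 0 ∧ M *ᵥ v = c • v}

/-- `‖A‖₂² = λ_max(A'A)`, the squared spectral norm. -/
def specNormSq {m n : Type*} [Fintype m] [Fintype n] (A : Matrix m n ℝ) : ℝ :=
  sSup (eigenvalueSet (Aᵀ * A))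

/-- `‖A‖_min²`, the smallest eigenvalue of `A'A` or of `AA'`, whichever matrix is smaller. -/
def minNormSq {m n : Type*} [Fintype m] [Fintype n] (A : Matrix m n ℝ) : ℝ :=
  if Fintype.card n ≤ Fintype.card m then sInf (eigenvalueSet (Aᵀ * A))
  else sInf (eigenvalueSet (A * Aᵀ))

/-- The distance `D(M(U), M(V))` between the column spaces of two matrices of full column rank,
`(1 - tr(U (U'U)⁻¹ U' V (V'V)⁻¹ V') / max(k, l))^{1/2}`. -/
def spaceDist {ι : Type*} [Fintype ι] {k l : ℕ}
    (U : Matrix ι (Fin k) ℝ) (V : Matrix ι (Fin l) ℝ) : ℝ :=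
  Real.sqrt (1 - ((U * (Uᵀ * U)⁻¹ * Uᵀ) * (V * (Vᵀ * V)⁻¹ * Vᵀ)).trace / (max k l : ℕ))

open Classical in
/-- The columns of `U` are orthonormal, and the `j`-th one is an eigenvector of the symmetric
matrix `M` for its `j`-th largest eigenvalue, counted with multiplicity
(`Matrix.IsHermitian.eigenvalues₀` lists the eigenvalues in decreasing order). -/
def IsLeadingEigenvectors {ι : Type*} [Fintype ι] {d : ℕ}
    (M : Matrix ι ι ℝ) (U : Matrix ι (Fin d) ℝ) : Prop :=
  Uᵀ * U = 1 ∧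
    ∃ (hM : M.IsHermitian) (hd : d ≤ Fintype.card ι),
      ∀ j : Fin d, M *ᵥ (fun i => U i j) = hM.eigenvalues₀ (Fin.castLE hd j) • fun i => U i j

/-! ### Stochastic notions -/

/-- `R N = O_p(ρ N)` as `N → ∞`. -/
def IsBigOp {Ω : Type*} [MeasurableSpace Ω] (μ : Measure Ω) (R : ℕ → Ω → ℝ) (ρ : ℕ → ℝ) : Prop :=
  ∀ η : ℝ, 0 < η → ∃ K : ℝ, 0 < K ∧
    ∀ᶠ N in atTop, μ {ω | K * ρ N < |R N ω|} ≤ ENNReal.ofReal η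

section MixingNotions

variable {Ω : Type*} [MeasurableSpace Ω] {d r : ℕ}

/-- The σ-field generated by `vec(X_t)`, `t ∈ I`. -/
abbrev sigmaField (X : ℤ → Ω → Matrix (Fin d) (Fin r) ℝ) (I : Set ℤ) : MeasurableSpace Ω :=
  ⨆ t ∈ I, MeasurableSpace.comap (fun ω (k : Fin d × Fin r) => X t ω k.1 k.2) inferInstance

/-- The α-mixing coefficient at lag `h`. -/
def alphaMixing (μ : Measure Ω) (X : ℤ → Ω → Matrix (Fin d) (Fin r) ℝ) (h : ℕ) : ℝ :=
  sSup {x | ∃ (τ : ℤ) (A B : Set Ω), MeasurableSet[sigmaField X (Set.Iic τ)] A ∧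
    MeasurableSet[sigmaField X (Set.Ici (τ + h))] B ∧
    x = |μ.real (A ∩ B) - μ.real A * μ.real B|}

/-- Strict stationarity: the law of the whole process is invariant under time shifts. -/
def StrictlyStationary (μ : Measure Ω) (X : ℤ → Ω → Matrix (Fin d) (Fin r) ℝ) : Prop :=
  ∀ s : ℤ, μ.map (fun ω (t : ℤ) (k : Fin d × Fin r) => X (t + s) ω k.1 k.2) =
    μ.map (fun ω (t : ℤ) (k : Fin d × Fin r) => X t ω k.1 k.2)

/-- `Σ_f(h) = Cov(vec(X_t), vec(X_{t+h}))`, which does not depend on `t` for a stationary `X`. -/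
def lagCov (μ : Measure Ω) (X : ℤ → Ω → Matrix (Fin d) (Fin r) ℝ) (h : ℕ) :
    Matrix (Fin d × Fin r) (Fin d × Fin r) ℝ :=
  Matrix.of fun k l => cov[fun ω => X 0 ω k.1 k.2, fun ω => X h ω l.1 l.2; μ]

end MixingNotions

/-! ### The model -/

/-- The data of the asymptotic setting, indexed by `N`: at stage `N` one observes a
`p N`-dimensional spatio-temporal process at the sites in `S₁ N ∪ S₂ N` and at times
`1, …, T N`. The latent `d × r` factor process `X` and the loading functions `a` are fixed. -/
structure Model (Ω : Type*) (d r : ℕ) (𝒮 : Set (EuclideanSpace ℝ (Fin 2))) where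
  /-- latent matrix factor process -/
  X : ℤ → Ω → Matrix (Fin d) (Fin r) ℝ
  /-- spatial loading functions, `a s = (a_1(s), …, a_d(s))` -/
  a : 𝒮 → Fin d → ℝ
  /-- number of variables -/
  p : ℕ → ℕ
  /-- number of time points -/
  T : ℕ → ℕ
  /-- first set of the partition of the sampling sites -/
  S₁ : ℕ → Finset 𝒮
  /-- second set of the partition of the sampling sites -/
  S₂ : ℕ → Finset 𝒮
  /-- variable loading matrix -/
  B : (N : ℕ) → Matrix (Fin (p N)) (Fin r) ℝ
  /-- additive error (nugget) process -/
  ε : (N : ℕ) → ℤ → Ω → 𝒮 → Fin (p N) → ℝ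

namespace Model

variable {Ω : Type*} {d r : ℕ} {𝒮 : Set (EuclideanSpace ℝ (Fin 2))} (m : Model Ω d r 𝒮)

/-- `n₁` -/
def n₁ (N : ℕ) : ℕ := (m.S₁ N).card

/-- `n₂` -/
def n₂ (N : ℕ) : ℕ := (m.S₂ N).card

/-- `n = n₁ + n₂` -/
def n (N : ℕ) : ℕ := m.n₁ N + m.n₂ N

/-- The observed process `y_t(s) = B X_t' a(s) + ε_t(s)`. -/
def y (N : ℕ) (t : ℤ) (ω : Ω) (s : 𝒮) : Fin (m.p N) → ℝ :=
  (m.B N * (m.X t ω)ᵀ) *ᵥ m.a s + m.ε N t ω s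

/-- `A₁`, with rows `a(s)'`, `s ∈ S₁`. -/
def A₁ (N : ℕ) : Matrix (m.S₁ N) (Fin d) ℝ := Matrix.of fun s => m.a s

/-- `A₂`, with rows `a(s)'`, `s ∈ S₂`. -/
def A₂ (N : ℕ) : Matrix (m.S₂ N) (Fin d) ℝ := Matrix.of fun s => m.a s

/-- Sample cross-space covariance `Ω̂_{A,ij} = T⁻¹ ∑_{t=1}^T Y_{1t,·i} Y_{2t,·j}'`. -/
def sampleOmega (N : ℕ) (ω : Ω) (i j : Fin (m.p N)) : Matrix (m.S₁ N) (m.S₂ N) ℝ :=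
  (m.T N : ℝ)⁻¹ • ∑ t ∈ Finset.Icc 1 (m.T N),
    Matrix.vecMulVec (fun u : m.S₁ N => m.y N t ω u i) (fun v : m.S₂ N => m.y N t ω v j)

/-- `M̂_{A₁}` -/
def sampleM₁ (N : ℕ) (ω : Ω) : Matrix (m.S₁ N) (m.S₁ N) ℝ :=
  ∑ i, ∑ j, m.sampleOmega N ω i j * (m.sampleOmega N ω i j)ᵀ

/-- `M̂_{A₂}` -/
def sampleM₂ (N : ℕ) (ω : Ω) : Matrix (m.S₂ N) (m.S₂ N) ℝ :=
  ∑ i, ∑ j, (m.sampleOmega N ω i j)ᵀ * m.sampleOmega N ω i j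

variable [MeasurableSpace Ω] (μ : Measure Ω)

/-- Cross-space covariance `Ω_{A,ij} = Cov(Y_{1t,·i}, Y_{2t,·j})`. It does not depend on `t`
under the assumptions below, and is taken at `t = 0`. -/
def popOmega (N : ℕ) (i j : Fin (m.p N)) : Matrix (m.S₁ N) (m.S₂ N) ℝ :=
  Matrix.of fun u v => cov[fun ω => m.y N 0 ω u i, fun ω => m.y N 0 ω v j; μ]

/-- `M_{A₁}` -/
def popM₁ (N : ℕ) : Matrix (m.S₁ N) (m.S₁ N) ℝ :=
  ∑ i, ∑ j, m.popOmega μ N i j * (m.popOmega μ N i j)ᵀ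

/-- `M_{A₂}` -/
def popM₂ (N : ℕ) : Matrix (m.S₂ N) (m.S₂ N) ℝ :=
  ∑ i, ∑ j, (m.popOmega μ N i j)ᵀ * m.popOmega μ N i j

/-- Sampling design: two disjoint sets of at least `d` sites each; `n`, `p`, `T` tend to
infinity while `d` and `r` stay fixed. -/
structure Design : Prop where
  disjoint : ∀ N, Disjoint (m.S₁ N) (m.S₂ N)
  d_le_n₁ : ∀ N, d ≤ m.n₁ N
  d_le_n₂ : ∀ N, d ≤ m.n₂ N
  n_tendsto : Tendsto m.n atTop atTop
  p_tendsto : Tendsto m.p atTop atTop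
  T_tendsto : Tendsto m.T atTop atTop

/-- The nugget process is centered white noise with bounded variances, uncorrelated over space;
the fields `ε_t`, `t ∈ ℤ`, are independent of each other and of the factor process. The mixed
moment bound follows from the variance bound if the nugget is independent over space, and holds
as well if fourth moments are bounded. -/
structure NuggetNoise : Prop where
  measurable : ∀ N t s i, Measurable fun ω => m.ε N t ω s i
  memLp : ∀ N t s i, MemLp (fun ω => m.ε N t ω s i) 2 μ
  mean_zero : ∀ N t s i, ∫ ω, m.ε N t ω s i ∂μ = 0
  uncorrelated : ∀ N t (u v : 𝒮), u ≠ v → ∀ i j,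
    cov[fun ω => m.ε N t ω u i, fun ω => m.ε N t ω v j; μ] = 0
  indep_time : ∀ N,
    iIndepFun (fun (t : ℤ) ω (k : 𝒮 × Fin (m.p N)) => m.ε N t ω k.1 k.2) μ
  indep_factor : ∀ N,
    IndepFun (fun ω (t : ℤ) (k : Fin d × Fin r) => m.X t ω k.1 k.2)
      (fun ω (t : ℤ) (k : 𝒮 × Fin (m.p N)) => m.ε N t ω k.1 k.2) μ
  bounded : ∃ K : ℝ,
    (∀ N t, ∀ u ∈ (m.S₁ N : Set 𝒮) ∪ m.S₂ N, ∀ i, ∫ ω, (m.ε N t ω u i) ^ 2 ∂μ ≤ K) ∧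
    (∀ N t, ∀ u ∈ m.S₁ N, ∀ v ∈ m.S₂ N, ∀ i j,
      Integrable (fun ω => (m.ε N t ω u i) ^ 2 * (m.ε N t ω v j) ^ 2) μ ∧
        ∫ ω, (m.ε N t ω u i) ^ 2 * (m.ε N t ω v j) ^ 2 ∂μ ≤ K)

/-- Identification: `M_{A₁}` and `M_{A₂}` have `d` positive eigenvalues. -/
def Identified : Prop :=
  ∀ᶠ N in atTop, (m.popM₁ μ N).rank = d ∧ (m.popM₂ μ N).rank = d

/-- The latent factor is centered, strictly stationary and α-mixing with
`∑_{h ≥ 1} α(h)^{1 - 2/q} < ∞`, where `q > 2`. -/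
structure MixingCondition (q : ℝ) : Prop where
  measurable : ∀ t i j, Measurable fun ω => m.X t ω i j
  mean_zero : ∀ t i j, ∫ ω, m.X t ω i j ∂μ = 0
  stationary : StrictlyStationary μ m.X
  two_lt : 2 < q
  mixing : Summable fun h : ℕ => alphaMixing μ m.X (h + 1) ^ (1 - 2 / q)

/-- Bounded moments of order `2q` of the factor, and for some lag `h ≥ 1` a lagged covariance
`Σ_f(h)` whose `max(d, r)`-th singular value is positive, with nonzero lagged autocovariance of
each row and each column of the factor. -/
structure MomentRankCondition (q : ℝ) : Prop where
  moments : ∃ C : ℝ, 0 < C ∧ ∀ t i j, Integrable (fun ω => |m.X t ω i j| ^ (2 * q)) μ ∧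
    ∫ ω, |m.X t ω i j| ^ (2 * q) ∂μ ≤ C
  lagged : ∃ h : ℕ, 1 ≤ h ∧ max d r ≤ (lagCov μ m.X h).rank ∧
    (∀ i : Fin d, ∃ j l : Fin r, cov[fun ω => m.X 0 ω i j, fun ω => m.X h ω i l; μ] ≠ 0) ∧
    (∀ j : Fin r, ∃ i k : Fin d, cov[fun ω => m.X 0 ω i j, fun ω => m.X h ω k j; μ] ≠ 0)

/-- Spatial factor strength `δ ∈ [0, 1]`. -/
structure SpatialStrength (δ : ℝ) : Prop where
  mem : δ ∈ Set.Icc (0 : ℝ) 1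
  min₁ : (fun N => minNormSq (m.A₁ N)) =Θ[atTop] fun N => (m.n₁ N : ℝ) ^ (1 - δ)
  max₁ : (fun N => specNormSq (m.A₁ N)) =Θ[atTop] fun N => (m.n₁ N : ℝ) ^ (1 - δ)
  min₂ : (fun N => minNormSq (m.A₂ N)) =Θ[atTop] fun N => (m.n₂ N : ℝ) ^ (1 - δ)
  max₂ : (fun N => specNormSq (m.A₂ N)) =Θ[atTop] fun N => (m.n₂ N : ℝ) ^ (1 - δ)

/-- Variable factor strength `γ ∈ [0, 1]`. -/
structure VariableStrength (γ : ℝ) : Prop where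
  mem : γ ∈ Set.Icc (0 : ℝ) 1
  min : (fun N => minNormSq (m.B N)) =Θ[atTop] fun N => (m.p N : ℝ) ^ (1 - γ)
  max : (fun N => specNormSq (m.B N)) =Θ[atTop] fun N => (m.p N : ℝ) ^ (1 - γ)

/-- The rate
`((n₁ n₂^{δ-1} p^γ + n₁^{δ-1} n₂ p^γ + n₁^δ n₂^δ p^{2γ}) T⁻¹)^{1/2}`. -/
def rate (δ γ : ℝ) (N : ℕ) : ℝ :=
  Real.sqrt
    (((m.n₁ N : ℝ) * (m.n₂ N : ℝ) ^ (δ - 1) * (m.p N : ℝ) ^ γ +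
      (m.n₁ N : ℝ) ^ (δ - 1) * (m.n₂ N : ℝ) * (m.p N : ℝ) ^ γ +
      (m.n₁ N : ℝ) ^ δ * (m.n₂ N : ℝ) ^ δ * (m.p N : ℝ) ^ (2 * γ)) * (m.T N : ℝ)⁻¹)

/-- The rate `n^δ p^γ T^{-1/2}`. -/
def balancedRate (δ γ : ℝ) (N : ℕ) : ℝ :=
  (m.n N : ℝ) ^ δ * (m.p N : ℝ) ^ γ * (m.T N : ℝ) ^ (-(1 / 2) : ℝ)

end Model

end SpatialFactor

end

/-! With `y_t = L (vec X_t) + ε_t` and `L_l = A_l ⊗ B`, the blocks `Ω̂_{ij}` form one matrix, the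
sample cross-moment of the two vectorized samples, and `M̂₁ = Ŵ Ŵ'` where `Ŵ` is the concatenation
of all the `Ω̂_{ij}`. Its population version is `W = A₁ G`, where `G = F (B ⊗ L₂)'` and `F` is a
rearrangement of `Cov(vec X_t)` that the identification condition forces to have rank `d`. Hence
`|W' x|² ≥ s |x|²` on the column space of `A₁`, with `s` of order
`n₁^{1-δ} n₂^{1-δ} p^{2-2γ}`.

An eigenvalue comparison in the spirit of Davis and Kahan, applied to `Ŵ` rather than to `Ŵ Ŵ'`,
gives `s D² ≤ 4 ‖Ŵ - W‖²` in Frobenius norm for every sample. Since `S₁` and `S₂` are disjoint, the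
noise does not bias `Ŵ`, and each of its entries is an average over `t` of variables that are
orthogonal or, by Davydov's inequality, have summable covariances. So `E ‖Ŵ - W‖²` is at most of
order `n₁ n₂ p² / T`, and Markov's inequality gives the rate `n₁^δ n₂^δ p^{2γ} / T` for `D²`. -/

noncomputable section

namespace SpatialFactor

open scoped Matrix.Norms.Frobenius

/-! ### Quadratic forms and eigenvalues -/

section QuadraticForms

variable {ι κ : Type*} [Fintype ι]

theorem isHermitian_transpose_mul_self (A : Matrix ι κ ℝ) : (Aᵀ * A).IsHermitian := by
  simpa using Matrix.isHermitian_conjTranspose_mul_self A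

theorem dotProduct_self_nonneg (v : ι → ℝ) : 0 ≤ v ⬝ᵥ v := by
  simpa using dotProduct_star_self_nonneg v

theorem dotProduct_self_pos {v : ι → ℝ} (hv : v ≠ 0) : 0 < v ⬝ᵥ v := by
  simpa using Matrix.dotProduct_star_self_pos_iff.2 hv

theorem dotProduct_self_eq_sum_sq (v : ι → ℝ) : v ⬝ᵥ v = ∑ i, v i ^ 2 := by
  simp only [dotProduct, sq]

variable [Fintype κ]

theorem dotProduct_transpose_mul_mulVec (A : Matrix ι κ ℝ) (v : κ → ℝ) :
    v ⬝ᵥ ((Aᵀ * A) *ᵥ v) = (A *ᵥ v) ⬝ᵥ (A *ᵥ v) := by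
  rw [← Matrix.mulVec_mulVec, Matrix.dotProduct_mulVec, Matrix.vecMul_transpose]

theorem frobenius_norm_sq (A : Matrix ι κ ℝ) : ‖A‖ ^ 2 = ∑ i, ∑ j, A i j ^ 2 := by
  have h : 0 ≤ ∑ i, ∑ j, A i j ^ 2 := by positivity
  simp only [Matrix.frobenius_norm_def, Real.rpow_two, Real.norm_eq_abs, sq_abs,
    ← Real.sqrt_eq_rpow, Real.sq_sqrt h]

theorem frobenius_norm_sq_eq_sum_col (A : Matrix ι κ ℝ) :
    ‖A‖ ^ 2 = ∑ j, A.col j ⬝ᵥ A.col j := by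
  simp only [frobenius_norm_sq, dotProduct_self_eq_sum_sq, Matrix.col_apply]
  exact Finset.sum_comm

theorem frobenius_norm_sq_eq_trace (A : Matrix ι κ ℝ) : ‖A‖ ^ 2 = (Aᵀ * A).trace := by
  rw [frobenius_norm_sq_eq_sum_col]
  rfl

theorem mulVec_dotProduct_self_le (A : Matrix ι κ ℝ) (v : κ → ℝ) :
    (A *ᵥ v) ⬝ᵥ (A *ᵥ v) ≤ ‖A‖ ^ 2 * (v ⬝ᵥ v) := by
  rw [frobenius_norm_sq, dotProduct_self_eq_sum_sq, dotProduct_self_eq_sum_sq, Finset.sum_mul]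
  exact Finset.sum_le_sum fun i _ => Finset.sum_mul_sq_le_sq_mul_sq Finset.univ (A i) v

theorem exists_diagonalization [DecidableEq ι] {M : Matrix ι ι ℝ} (hM : M.IsHermitian) :
    ∃ R : Matrix ι ι ℝ, ∀ v : ι → ℝ,
      v ⬝ᵥ v = ∑ i, (R *ᵥ v) i ^ 2 ∧ v ⬝ᵥ (M *ᵥ v) = ∑ i, hM.eigenvalues i * (R *ᵥ v) i ^ 2 := by
  set V : Matrix ι ι ℝ := (hM.eigenvectorUnitary : Matrix ι ι ℝ) with hV
  have hVV : V * Vᵀ = 1 := by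
    simpa [Matrix.star_eq_conjTranspose] using Unitary.coe_mul_star_self hM.eigenvectorUnitary
  have hspec : M = V * Matrix.diagonal hM.eigenvalues * Vᵀ := by
    conv_lhs => rw [hM.spectral_theorem]
    simp [Unitary.conjStarAlgAut_apply, Matrix.star_eq_conjTranspose, hV]
  refine ⟨Vᵀ, fun v => ⟨?_, ?_⟩⟩
  · rw [← dotProduct_self_eq_sum_sq, ← dotProduct_transpose_mul_mulVec, Matrix.transpose_transpose,
      hVV, Matrix.one_mulVec]
  · conv_lhs => rw [hspec]
    rw [← Matrix.mulVec_mulVec, ← Matrix.mulVec_mulVec, Matrix.dotProduct_mulVec,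
      ← Matrix.mulVec_transpose]
    simp only [dotProduct, Matrix.mulVec_diagonal]
    exact Finset.sum_congr rfl fun i _ => by ring

theorem eigenvalues_mem_eigenvalueSet [DecidableEq ι] {M : Matrix ι ι ℝ} (hM : M.IsHermitian)
    (i : ι) : hM.eigenvalues i ∈ eigenvalueSet M := by
  refine ⟨(hM.eigenvectorBasis i).ofLp, fun h => ?_, hM.mulVec_eigenvectorBasis i⟩
  exact hM.eigenvectorBasis.orthonormal.ne_zero i (PiLp.ext fun k => congrFun h k)

theorem eigenvalueSet_transpose_mul_self_subset (A : Matrix ι κ ℝ) :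
    eigenvalueSet (Aᵀ * A) ⊆ Set.Icc 0 (‖A‖ ^ 2) := by
  rintro c ⟨v, hv, h⟩
  have hpos := dotProduct_self_pos hv
  have hform : c * (v ⬝ᵥ v) = (A *ᵥ v) ⬝ᵥ (A *ᵥ v) := by
    rw [← dotProduct_transpose_mul_mulVec, h, dotProduct_smul, smul_eq_mul]
  exact ⟨nonneg_of_mul_nonneg_left (hform ▸ dotProduct_self_nonneg _) hpos,
    le_of_mul_le_mul_right (hform ▸ mulVec_dotProduct_self_le A v) hpos⟩

theorem minNormSq_nonneg (A : Matrix ι κ ℝ) : 0 ≤ minNormSq A := by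
  unfold minNormSq
  split_ifs
  · exact Real.sInf_nonneg fun c hc => (eigenvalueSet_transpose_mul_self_subset A hc).1
  · exact Real.sInf_nonneg fun c hc => (eigenvalueSet_transpose_mul_self_subset Aᵀ (by simpa)).1

theorem frobenius_norm_sq_le_card_mul_specNormSq (A : Matrix ι κ ℝ) :
    ‖A‖ ^ 2 ≤ Fintype.card κ * specNormSq A := by
  classical
  have hM := isHermitian_transpose_mul_self A
  rw [frobenius_norm_sq_eq_trace, hM.trace_eq_sum_eigenvalues, ← nsmul_eq_mul, ← Finset.card_univ]
  refine Finset.sum_le_card_nsmul _ _ _ fun i _ => ?_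
  exact le_csSup ⟨‖A‖ ^ 2, fun c hc => (eigenvalueSet_transpose_mul_self_subset A hc).2⟩
    (eigenvalues_mem_eigenvalueSet hM i)

/-- Lower bound `c |v|² ≤ |A v|²`: the smallest eigenvalue of `Aᵀ A` is at least `c`. In this form
the bound can be composed along products of matrices. -/
def ExpandsBy (c : ℝ) (A : Matrix ι κ ℝ) : Prop :=
  ∀ v, c * (v ⬝ᵥ v) ≤ (A *ᵥ v) ⬝ᵥ (A *ᵥ v)

theorem expandsBy_minNormSq (A : Matrix ι κ ℝ) (h : Fintype.card κ ≤ Fintype.card ι) :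
    ExpandsBy (minNormSq A) A := by
  classical
  intro v
  have hM := isHermitian_transpose_mul_self A
  obtain ⟨R, hR⟩ := exists_diagonalization hM
  rw [← dotProduct_transpose_mul_mulVec, (hR v).1, (hR v).2, Finset.mul_sum]
  refine Finset.sum_le_sum fun i _ => mul_le_mul_of_nonneg_right ?_ (sq_nonneg _)
  rw [minNormSq, if_pos h]
  exact csInf_le ⟨0, fun c hc => (eigenvalueSet_transpose_mul_self_subset A hc).1⟩
    (eigenvalues_mem_eigenvalueSet hM i)

theorem ExpandsBy.injective {c : ℝ} {A : Matrix ι κ ℝ} (hA : ExpandsBy c A) (hc : 0 < c) :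
    Function.Injective A.mulVec := fun x y hxy => by
  have h : A *ᵥ (x - y) = 0 := by rw [Matrix.mulVec_sub, sub_eq_zero.2 hxy]
  by_contra hne
  have hpos := mul_pos hc (dotProduct_self_pos (sub_ne_zero.2 hne))
  have hle := hA (x - y)
  rw [h, dotProduct_zero] at hle
  exact hle.not_gt hpos

theorem ExpandsBy.mul {η : Type*} [Fintype η] {a b : ℝ} {A : Matrix ι κ ℝ} {B : Matrix κ η ℝ}
    (hA : ExpandsBy a A) (hB : ExpandsBy b B) (ha : 0 ≤ a) :
    ExpandsBy (a * b) (A * B) := fun v => by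
  rw [← Matrix.mulVec_mulVec, mul_assoc]
  exact (mul_le_mul_of_nonneg_left (hB v) ha).trans (hA _)

theorem ExpandsBy.transpose_mulVec {c : ℝ} {A : Matrix ι κ ℝ} (hA : ExpandsBy c A) (hc : 0 ≤ c)
    (x : κ → ℝ) :
    c * ((A *ᵥ x) ⬝ᵥ (A *ᵥ x)) ≤ (Aᵀ *ᵥ (A *ᵥ x)) ⬝ᵥ (Aᵀ *ᵥ (A *ᵥ x)) := by
  set z := Aᵀ *ᵥ (A *ᵥ x) with hz
  have hxz : (A *ᵥ x) ⬝ᵥ (A *ᵥ x) = x ⬝ᵥ z := by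
    rw [← dotProduct_transpose_mul_mulVec, hz, Matrix.mulVec_mulVec]
  have hcs : (x ⬝ᵥ z) ^ 2 ≤ (x ⬝ᵥ x) * (z ⬝ᵥ z) := by
    rw [dotProduct_self_eq_sum_sq, dotProduct_self_eq_sum_sq]
    exact Finset.sum_mul_sq_le_sq_mul_sq Finset.univ x z
  have hx := hA x
  rw [hxz] at hx ⊢
  have hnn : 0 ≤ x ⬝ᵥ z := hxz ▸ dotProduct_self_nonneg _
  rcases hnn.eq_or_lt with h0 | hpos
  · simpa [← h0] using dotProduct_self_nonneg z
  refine le_of_mul_le_mul_right ?_ hpos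
  calc c * (x ⬝ᵥ z) * (x ⬝ᵥ z) = c * (x ⬝ᵥ z) ^ 2 := by ring
    _ ≤ c * ((x ⬝ᵥ x) * (z ⬝ᵥ z)) := by gcongr
    _ = c * (x ⬝ᵥ x) * (z ⬝ᵥ z) := by ring
    _ ≤ x ⬝ᵥ z * (z ⬝ᵥ z) := mul_le_mul_of_nonneg_right hx (dotProduct_self_nonneg z)
    _ = z ⬝ᵥ z * (x ⬝ᵥ z) := mul_comm _ _

theorem isUnit_det_transpose_mul_self [DecidableEq κ] {A : Matrix ι κ ℝ}
    (hA : Function.Injective A.mulVec) : IsUnit (Aᵀ * A).det := by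
  simpa using (Matrix.PosDef.conjTranspose_mul_self A hA).det_pos.ne'

theorem exists_expandsBy_of_injective {A : Matrix ι κ ℝ} (hA : Function.Injective A.mulVec) :
    ∃ c > 0, ExpandsBy c A := by
  classical
  set R := (Aᵀ * A)⁻¹ * Aᵀ
  have hR : R * A = 1 := by
    rw [Matrix.mul_assoc, Matrix.nonsing_inv_mul _ (isUnit_det_transpose_mul_self hA)]
  refine ⟨(‖R‖ ^ 2 + 1)⁻¹, by positivity, fun v => ?_⟩
  rw [inv_mul_le_iff₀ (by positivity)]
  calc v ⬝ᵥ v = (R *ᵥ (A *ᵥ v)) ⬝ᵥ (R *ᵥ (A *ᵥ v)) := by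
        rw [Matrix.mulVec_mulVec, hR, Matrix.one_mulVec]
    _ ≤ ‖R‖ ^ 2 * ((A *ᵥ v) ⬝ᵥ (A *ᵥ v)) := mulVec_dotProduct_self_le R _
    _ ≤ (‖R‖ ^ 2 + 1) * ((A *ᵥ v) ⬝ᵥ (A *ᵥ v)) :=
        mul_le_mul_of_nonneg_right (by linarith) (dotProduct_self_nonneg _)

theorem le_eigenvalues₀_of_le_on_range [DecidableEq ι] {M : Matrix ι ι ℝ} (hM : M.IsHermitian)
    {d : ℕ} {A : Matrix ι (Fin d) ℝ} (hA : Function.Injective A.mulVec) {c : ℝ}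
    (hc : ∀ x, c * ((A *ᵥ x) ⬝ᵥ (A *ᵥ x)) ≤ (A *ᵥ x) ⬝ᵥ (M *ᵥ (A *ᵥ x)))
    (hd : d ≤ Fintype.card ι) (j : Fin d) : c ≤ hM.eigenvalues₀ (Fin.castLE hd j) := by
  obtain ⟨R, hR⟩ := exists_diagonalization hM
  let e : Fin (Fintype.card ι) ≃ ι := Fintype.equivOfCardEq (Fintype.card_fin _)
  -- A vector of the `d`-dimensional range of `A` can be chosen orthogonal to the first `j < d`
  -- eigenvectors, so that its Rayleigh quotient is at most the `j`-th eigenvalue.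
  let P : Matrix (Fin j) (Fin d) ℝ := Matrix.of fun k => (R * A) (e ⟨k, by omega⟩)
  have hker : LinearMap.ker P.mulVecLin ≠ ⊥ := LinearMap.ker_ne_bot_of_finrank_lt (by simp)
  obtain ⟨x, hx, hx0⟩ := Submodule.exists_mem_ne_zero_of_ne_bot hker
  set v := A *ᵥ x with hv
  have hvpos : 0 < v ⬝ᵥ v :=
    dotProduct_self_pos fun h => hx0 (hA (h.trans (Matrix.mulVec_zero A).symm))
  have hzero : ∀ i : ι, (e.symm i : ℕ) < j → (R *ᵥ v) i = 0 := fun i hi => by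
    have hPx : (P *ᵥ x) ⟨e.symm i, hi⟩ = 0 := congrFun (LinearMap.mem_ker.1 hx) _
    rw [hv, Matrix.mulVec_mulVec, ← hPx]
    simp only [P, Matrix.mulVec, Matrix.of_apply, Fin.eta, Equiv.apply_symm_apply]
  refine le_of_mul_le_mul_right ((hc x).trans ?_) hvpos
  rw [(hR v).1, (hR v).2, Finset.mul_sum]
  refine Finset.sum_le_sum fun i _ => ?_
  rcases lt_or_ge (e.symm i : ℕ) j with hi | hi
  · simp [hzero i hi]
  · exact mul_le_mul_of_nonneg_right (hM.eigenvalues₀_antitone (Fin.le_def.2 hi)) (sq_nonneg _)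

end QuadraticForms

/-! ### Perturbation of the leading eigenspace -/

section Projection

variable {ι κ : Type*} [Fintype ι] [Fintype κ] [DecidableEq κ]

/-- The orthogonal projection onto the column space of `A`, for `A` of full column rank. -/
def colProj (A : Matrix ι κ ℝ) : Matrix ι ι ℝ := A * (Aᵀ * A)⁻¹ * Aᵀ

theorem colProj_transpose (A : Matrix ι κ ℝ) : (colProj A)ᵀ = colProj A := by
  simp [colProj, Matrix.transpose_mul, Matrix.transpose_nonsing_inv, Matrix.mul_assoc]

variable {A : Matrix ι κ ℝ} (hA : Function.Injective A.mulVec)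

include hA

theorem colProj_mul_self : colProj A * A = A := by
  rw [colProj, Matrix.mul_assoc, Matrix.mul_assoc,
    Matrix.nonsing_inv_mul _ (isUnit_det_transpose_mul_self hA), Matrix.mul_one]

theorem colProj_mul_colProj : colProj A * colProj A = colProj A := by
  conv_lhs => enter [2]; rw [colProj]
  rw [← Matrix.mul_assoc, ← Matrix.mul_assoc, colProj_mul_self hA, colProj]

theorem transpose_mul_one_sub_colProj [DecidableEq ι] :
    (1 - colProj A)ᵀ * (1 - colProj A) = 1 - colProj A := by
  simp [colProj_transpose, Matrix.mul_sub, Matrix.sub_mul, colProj_mul_colProj hA]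

theorem one_sub_colProj_mulVec_dotProduct_self_le [DecidableEq ι] (v : ι → ℝ) :
    ((1 - colProj A) *ᵥ v) ⬝ᵥ ((1 - colProj A) *ᵥ v) ≤ v ⬝ᵥ v := by
  have hP : v ⬝ᵥ (colProj A *ᵥ v) = (colProj A *ᵥ v) ⬝ᵥ (colProj A *ᵥ v) := by
    rw [← dotProduct_transpose_mul_mulVec, colProj_transpose, colProj_mul_colProj hA]
  rw [← dotProduct_transpose_mul_mulVec, transpose_mul_one_sub_colProj hA, Matrix.sub_mulVec,
    Matrix.one_mulVec, dotProduct_sub, hP]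
  linarith [dotProduct_self_nonneg (colProj A *ᵥ v)]

theorem eigenvalue_mul_residual_le [DecidableEq ι] {η : Type*} [Fintype η] (G : Matrix κ η ℝ)
    (W : Matrix ι η ℝ) {c : ℝ} (hc : 0 < c) {u : ι → ℝ} (hu : (W * Wᵀ) *ᵥ u = c • u) :
    c * (((1 - colProj A) *ᵥ u) ⬝ᵥ ((1 - colProj A) *ᵥ u)) ≤ ‖W - A * G‖ ^ 2 * (u ⬝ᵥ u) := by
  set Q := 1 - colProj A
  have hQ : Q * (A * G) = 0 := by
    rw [← Matrix.mul_assoc, Matrix.sub_mul, colProj_mul_self hA, Matrix.one_mul, sub_self,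
      Matrix.zero_mul]
  have hQu : c • (Q *ᵥ u) = Q *ᵥ ((W - A * G) *ᵥ (Wᵀ *ᵥ u)) := by
    rw [← Matrix.mulVec_smul, ← hu, Matrix.mulVec_mulVec, Matrix.mulVec_mulVec,
      Matrix.mulVec_mulVec, Matrix.mul_sub, hQ, sub_zero, Matrix.mul_assoc]
  have hWu : (Wᵀ *ᵥ u) ⬝ᵥ (Wᵀ *ᵥ u) = c * (u ⬝ᵥ u) := by
    rw [← dotProduct_transpose_mul_mulVec, Matrix.transpose_transpose, hu, dotProduct_smul,
      smul_eq_mul]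
  refine le_of_mul_le_mul_left ?_ hc
  calc c * (c * ((Q *ᵥ u) ⬝ᵥ (Q *ᵥ u))) = (c • (Q *ᵥ u)) ⬝ᵥ (c • (Q *ᵥ u)) := by
        rw [smul_dotProduct, dotProduct_smul, smul_eq_mul, smul_eq_mul]
    _ ≤ ((W - A * G) *ᵥ (Wᵀ *ᵥ u)) ⬝ᵥ ((W - A * G) *ᵥ (Wᵀ *ᵥ u)) := by
        rw [hQu]
        exact one_sub_colProj_mulVec_dotProduct_self_le hA _
    _ ≤ ‖W - A * G‖ ^ 2 * (c * (u ⬝ᵥ u)) := hWu ▸ mulVec_dotProduct_self_le _ _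
    _ = c * (‖W - A * G‖ ^ 2 * (u ⬝ᵥ u)) := by ring

end Projection

section Perturbation

variable {ι κ : Type*} [Fintype ι] [Fintype κ] [DecidableEq ι] {d : ℕ} {A : Matrix ι (Fin d) ℝ}
  (hA : Function.Injective A.mulVec)

include hA

theorem spaceDist_sq_eq (hd : 0 < d) {U : Matrix ι (Fin d) ℝ}
    (hU : Uᵀ * U = 1) :
    spaceDist U A ^ 2 = ‖(1 - colProj A) * U‖ ^ 2 / d := by
  have htr : ((U * (Uᵀ * U)⁻¹ * Uᵀ) * (A * (Aᵀ * A)⁻¹ * Aᵀ)).trace =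
      (Uᵀ * colProj A * U).trace := by
    rw [hU, inv_one, Matrix.mul_one, Matrix.mul_assoc, Matrix.trace_mul_comm, colProj]
  have hnorm : ‖(1 - colProj A) * U‖ ^ 2 = d - (Uᵀ * colProj A * U).trace := by
    rw [frobenius_norm_sq_eq_trace, Matrix.transpose_mul, Matrix.mul_assoc,
      ← Matrix.mul_assoc _ _ U, transpose_mul_one_sub_colProj hA, Matrix.sub_mul, Matrix.one_mul,
      Matrix.mul_sub, hU, Matrix.trace_sub, Matrix.trace_one, Fintype.card_fin, Matrix.mul_assoc]
  have hd' : (d : ℝ) ≠ 0 := by positivity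
  have hdist : 1 - (Uᵀ * colProj A * U).trace / (max d d : ℕ) =
      ‖(1 - colProj A) * U‖ ^ 2 / d := by
    rw [hnorm, max_self, sub_div, div_self hd']
  rw [spaceDist, htr, hdist, Real.sq_sqrt (by positivity)]

theorem quarter_le_eigenvalues₀ {W What : Matrix ι κ ℝ} {s : ℝ}
    (hs : ∀ x, s * ((A *ᵥ x) ⬝ᵥ (A *ᵥ x)) ≤ (Wᵀ *ᵥ (A *ᵥ x)) ⬝ᵥ (Wᵀ *ᵥ (A *ᵥ x)))
    (hclose : 4 * ‖What - W‖ ^ 2 ≤ s) (hM : (What * Whatᵀ).IsHermitian)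
    (hd : d ≤ Fintype.card ι) (j : Fin d) : s / 4 ≤ hM.eigenvalues₀ (Fin.castLE hd j) := by
  refine le_eigenvalues₀_of_le_on_range hM hA (fun x => ?_) hd j
  set v := A *ᵥ x
  have hform : v ⬝ᵥ ((What * Whatᵀ) *ᵥ v) = (Whatᵀ *ᵥ v) ⬝ᵥ (Whatᵀ *ᵥ v) := by
    simpa using dotProduct_transpose_mul_mulVec Whatᵀ v
  have herr := mulVec_dotProduct_self_le (What - W)ᵀ v
  rw [Matrix.frobenius_norm_transpose, Matrix.transpose_sub, Matrix.sub_mulVec] at herr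
  have hpar : (Wᵀ *ᵥ v) ⬝ᵥ (Wᵀ *ᵥ v) ≤ 2 * ((Whatᵀ *ᵥ v) ⬝ᵥ (Whatᵀ *ᵥ v)) +
      2 * ((Whatᵀ *ᵥ v - Wᵀ *ᵥ v) ⬝ᵥ (Whatᵀ *ᵥ v - Wᵀ *ᵥ v)) := by
    simp only [dotProduct_self_eq_sum_sq, Finset.mul_sum, ← Finset.sum_add_distrib, Pi.sub_apply]
    exact Finset.sum_le_sum fun i _ => by
      nlinarith [sq_nonneg (2 * (Whatᵀ *ᵥ v) i - (Wᵀ *ᵥ v) i)]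
  rw [hform]
  nlinarith [hs x, mul_le_mul_of_nonneg_right hclose (dotProduct_self_nonneg v)]

omit [DecidableEq ι] in
theorem mul_spaceDist_sq_le (hd : 0 < d) {U : Matrix ι (Fin d) ℝ} {What : Matrix ι κ ℝ}
    {G : Matrix (Fin d) κ ℝ} (hU : IsLeadingEigenvectors (What * Whatᵀ) U) {s : ℝ}
    (hs : ∀ x, s * ((A *ᵥ x) ⬝ᵥ (A *ᵥ x)) ≤ ((A * G)ᵀ *ᵥ (A *ᵥ x)) ⬝ᵥ ((A * G)ᵀ *ᵥ (A *ᵥ x))) :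
    s * spaceDist U A ^ 2 ≤ 4 * ‖What - A * G‖ ^ 2 := by
  classical
  obtain ⟨hUU, hM, hdι, hev⟩ := hU
  rw [spaceDist_sq_eq hA hd hUU, frobenius_norm_sq_eq_sum_col, ← mul_div_assoc,
    div_le_iff₀ (by positivity), Finset.mul_sum]
  suffices hcol : ∀ j, s * (((1 - colProj A) * U).col j ⬝ᵥ ((1 - colProj A) * U).col j) ≤
      4 * ‖What - A * G‖ ^ 2 from
    (Finset.sum_le_card_nsmul _ _ _ fun j _ => hcol j).trans_eq (by simp [mul_comm])
  intro j
  have hunit : U.col j ⬝ᵥ U.col j = 1 := (congrFun₂ hUU j j).trans (Matrix.one_apply_eq j)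
  change s * (((1 - colProj A) *ᵥ U.col j) ⬝ᵥ ((1 - colProj A) *ᵥ U.col j)) ≤ _
  have hres0 := dotProduct_self_nonneg ((1 - colProj A) *ᵥ U.col j)
  have hres1 := one_sub_colProj_mulVec_dotProduct_self_le hA (U.col j)
  rcases lt_or_ge s (4 * ‖What - A * G‖ ^ 2) with hsmall | hlarge
  · nlinarith [sq_nonneg ‖What - A * G‖]
  rcases (show 0 ≤ s by nlinarith [sq_nonneg ‖What - A * G‖]).eq_or_lt with rfl | hpos
  · rw [zero_mul]
    positivity
  have hlam := quarter_le_eigenvalues₀ hA hs hlarge hM hdι j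
  have hres := eigenvalue_mul_residual_le hA G What (by linarith) (hev j)
  change _ * (((1 - colProj A) *ᵥ U.col j) ⬝ᵥ ((1 - colProj A) *ᵥ U.col j)) ≤
    _ * (U.col j ⬝ᵥ U.col j) at hres
  nlinarith

end Perturbation

/-! ### Kronecker products and unfoldings -/

section Kronecker

open scoped Kronecker

variable {ι κ η θ : Type*} [Fintype ι] [Fintype κ] [Fintype η] [Fintype θ]

theorem vec_dotProduct_self (A : Matrix ι κ ℝ) : A.vec ⬝ᵥ A.vec = ‖A‖ ^ 2 := by
  rw [Matrix.vec_dotProduct_vec, frobenius_norm_sq_eq_trace]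

theorem frobenius_norm_kronecker (A : Matrix ι κ ℝ) (B : Matrix η θ ℝ) :
    ‖A ⊗ₖ B‖ = ‖A‖ * ‖B‖ := by
  rw [← sq_eq_sq₀ (norm_nonneg _) (by positivity), mul_pow]
  simp only [frobenius_norm_sq, Fintype.sum_prod_type, Matrix.kroneckerMap_apply, mul_pow]
  simp only [Finset.sum_mul_sum]

theorem ExpandsBy.mul_norm_sq_le {a : ℝ} {A : Matrix ι κ ℝ} (hA : ExpandsBy a A)
    (H : Matrix κ η ℝ) : a * ‖H‖ ^ 2 ≤ ‖A * H‖ ^ 2 := by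
  rw [frobenius_norm_sq_eq_sum_col, frobenius_norm_sq_eq_sum_col, Finset.mul_sum]
  exact Finset.sum_le_sum fun j _ => hA (H.col j)

theorem ExpandsBy.kronecker {a b : ℝ} {A : Matrix ι κ ℝ} {B : Matrix η θ ℝ} (hA : ExpandsBy a A)
    (hB : ExpandsBy b B) (hb : 0 ≤ b) : ExpandsBy (a * b) (A ⊗ₖ B) := fun v => by
  obtain ⟨V, rfl⟩ := Matrix.vec_bijective.surjective v
  rw [Matrix.kronecker_mulVec_vec, vec_dotProduct_self, vec_dotProduct_self]
  calc a * b * ‖V‖ ^ 2 = b * (a * ‖Vᵀ‖ ^ 2) := by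
        rw [Matrix.frobenius_norm_transpose]
        ring
    _ ≤ b * ‖A * Vᵀ‖ ^ 2 := by
        gcongr
        exact hA.mul_norm_sq_le _
    _ = b * ‖V * Aᵀ‖ ^ 2 := by
        rw [← Matrix.frobenius_norm_transpose, Matrix.transpose_mul, Matrix.transpose_transpose]
    _ ≤ ‖B * V * Aᵀ‖ ^ 2 := by
        rw [Matrix.mul_assoc]
        exact hB.mul_norm_sq_le _

/-- The rearrangement of a matrix that moves the second factor `η` of its row index to the column
index. It turns the cross-covariance of `vec Y₁` and `vec Y₂` into the concatenation of all the
blocks `Ω_{ij}`. -/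
def unfoldRows (M : Matrix (ι × η) θ ℝ) : Matrix ι (η × θ) ℝ :=
  Matrix.of fun i k => M (i, k.1) k.2

theorem frobenius_norm_unfoldRows (M : Matrix (ι × η) θ ℝ) : ‖unfoldRows M‖ = ‖M‖ := by
  rw [← sq_eq_sq₀ (norm_nonneg _) (norm_nonneg _)]
  simp only [frobenius_norm_sq, unfoldRows, Fintype.sum_prod_type, Matrix.of_apply]

theorem unfoldRows_kronecker_mul {ζ ξ τ : Type*} (A : Matrix ζ ι ℝ) (B : Matrix ξ κ ℝ)
    (C : Matrix (ι × κ) η ℝ) (L : Matrix τ η ℝ) :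
    unfoldRows ((A ⊗ₖ B) * C * Lᵀ) = A * (unfoldRows C * (B ⊗ₖ L)ᵀ) := by
  ext i k
  simp only [unfoldRows, Matrix.mul_apply, Matrix.of_apply, Matrix.transpose_apply,
    Matrix.kroneckerMap_apply, Fintype.sum_prod_type, Finset.mul_sum, Finset.sum_mul]
  rw [Finset.sum_comm]
  refine Finset.sum_congr rfl fun _ _ => ?_
  rw [Finset.sum_comm]
  exact Finset.sum_congr rfl fun _ _ => Finset.sum_congr rfl fun _ _ => by ring

theorem transpose_mulVec_injective_of_le_rank {d : ℕ} {G : Matrix (Fin d) κ ℝ} (hG : d ≤ G.rank) :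
    Function.Injective Gᵀ.mulVec := by
  refine Matrix.mulVec_injective_iff.2 (linearIndependent_iff_card_le_finrank_span.2 ?_)
  rwa [Fintype.card_fin, Matrix.col_transpose, Set.finrank, ← Matrix.rank_eq_finrank_span_row]

theorem signal_lower_bound {A : Matrix ι κ ℝ} {C : Matrix κ η ℝ} {K : Matrix θ η ℝ} {a c k : ℝ}
    (hA : ExpandsBy a A) (hC : ExpandsBy c Cᵀ) (hK : ExpandsBy k K) (ha : 0 ≤ a) (hc : 0 ≤ c)
    (hk : 0 ≤ k) (x : κ → ℝ) :
    k * c * a * ((A *ᵥ x) ⬝ᵥ (A *ᵥ x)) ≤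
      ((A * (C * Kᵀ))ᵀ *ᵥ (A *ᵥ x)) ⬝ᵥ ((A * (C * Kᵀ))ᵀ *ᵥ (A *ᵥ x)) := by
  have hKC : ExpandsBy (k * c) (K * Cᵀ) := hK.mul hC hk
  have htr : (A * (C * Kᵀ))ᵀ = K * Cᵀ * Aᵀ := by
    simp only [Matrix.transpose_mul, Matrix.transpose_transpose]
  rw [htr, ← Matrix.mulVec_mulVec, mul_assoc (k * c)]
  exact (mul_le_mul_of_nonneg_left (hA.transpose_mulVec ha x) (by positivity)).trans (hKC _)

end Kronecker

/-! ### Covariances of weakly dependent variables -/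

section Mixing

variable {Ω : Type*} {m0 : MeasurableSpace Ω} {μ : Measure Ω}

theorem integral_abs_of_integral_eq_zero {g : Ω → ℝ} (hg : Measurable g) (hgi : Integrable g μ)
    (h0 : ∫ ω, g ω ∂μ = 0) : ∫ ω, |g ω| ∂μ = 2 * ∫ ω in {ω | 0 ≤ g ω}, g ω ∂μ := by
  have hA : MeasurableSet {ω | 0 ≤ g ω} := hg measurableSet_Ici
  have hpos : ∫ ω in {ω | 0 ≤ g ω}, |g ω| ∂μ = ∫ ω in {ω | 0 ≤ g ω}, g ω ∂μ :=
    setIntegral_congr_fun hA fun ω (hω : 0 ≤ g ω) => abs_of_nonneg hω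
  have hneg : ∫ ω in {ω | 0 ≤ g ω}ᶜ, |g ω| ∂μ = -∫ ω in {ω | 0 ≤ g ω}ᶜ, g ω ∂μ := by
    rw [← integral_neg]
    exact setIntegral_congr_fun hA.compl fun ω (hω : ¬0 ≤ g ω) => abs_of_neg (not_le.1 hω)
  linarith [integral_add_compl hA hgi.abs, integral_add_compl hA hgi]

theorem abs_sub_truncation_pow_le (U : Ω → ℝ) {M : ℝ} (hM : 0 < M) {q : ℝ} {k : ℕ} (hk : k ≠ 0)
    (hkq : k ≤ q) (ω : Ω) :
    |U ω - truncation U M ω| ^ k ≤ |U ω| ^ q * M ^ (k - q) := by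
  rcases lt_or_ge |U ω| M with h | h
  · rw [truncation_eq_self h, sub_self, abs_zero, zero_pow hk]
    positivity
  · have hpos : 0 < |U ω| := hM.trans_le h
    have htail : |U ω - truncation U M ω| ≤ |U ω| := by
      simp only [truncation, Set.indicator, Function.comp_apply, id]
      split_ifs <;> simp
    calc |U ω - truncation U M ω| ^ k ≤ |U ω| ^ k := pow_le_pow_left₀ (abs_nonneg _) htail k
      _ = |U ω| ^ q * |U ω| ^ (k - q) := by
          rw [← Real.rpow_add hpos, add_sub_cancel, Real.rpow_natCast]
      _ ≤ |U ω| ^ q * M ^ (k - q) := by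
          gcongr ?_ * ?_
          exact Real.rpow_le_rpow_of_nonpos hM h (by linarith)

theorem integral_abs_sub_truncation_pow_le {U : Ω → ℝ} {q C : ℝ}
    (hU : Integrable (fun ω => |U ω| ^ q) μ) (hC : ∫ ω, |U ω| ^ q ∂μ ≤ C) {M : ℝ} (hM : 0 < M)
    {k : ℕ} (hk : k ≠ 0) (hkq : k ≤ q) :
    ∫ ω, |U ω - truncation U M ω| ^ k ∂μ ≤ C * M ^ (k - q) :=
  calc ∫ ω, |U ω - truncation U M ω| ^ k ∂μ ≤ ∫ ω, |U ω| ^ q * M ^ (k - q) ∂μ :=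
        integral_mono_of_nonneg (ae_of_all _ fun _ => by positivity) (hU.mul_const _)
          (ae_of_all _ (abs_sub_truncation_pow_le U hM hk hkq))
    _ ≤ C * M ^ (k - q) := by
        rw [integral_mul_const]
        gcongr

variable [IsProbabilityMeasure μ]

theorem memLp_two_of_integrable_rpow {U : Ω → ℝ} {q : ℝ} (hU : AEStronglyMeasurable U μ)
    (hq : 2 ≤ q) (hUq : Integrable (fun ω => |U ω| ^ q) μ) : MemLp U 2 μ := by
  have := integrable_norm_rpow_of_le hU zero_le_two (by linarith) hq (by simpa using hUq)
  rw [memLp_two_iff_integrable_sq hU]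
  simpa using this

theorem covariance_eq_integral_mul_sub {U V : Ω → ℝ} (hU : MemLp U 2 μ) (hV : MemLp V 2 μ) :
    cov[U, V; μ] = ∫ ω, U ω * (V ω - ∫ ω', V ω' ∂μ) ∂μ := by
  have hUi := hU.integrable one_le_two
  simp only [mul_sub]
  rw [covariance_eq_sub hU hV, integral_sub (by exact hU.integrable_mul hV) (hUi.mul_const _),
    integral_mul_const]
  rfl

theorem abs_covariance_le_mul_integral_abs {U V : Ω → ℝ} {M : ℝ} (hM : ∀ ω, |U ω| ≤ M)
    (hU : MemLp U 2 μ) (hV : MemLp V 2 μ) : |cov[U, V; μ]| ≤ 2 * M * ∫ ω, |V ω| ∂μ := by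
  have hmean : |∫ ω, U ω ∂μ| ≤ M := by
    simpa using norm_integral_le_of_norm_le_const (f := U) (ae_of_all μ hM)
  rw [covariance_comm, covariance_eq_integral_mul_sub hV hU, ← integral_const_mul]
  refine abs_integral_le_integral_abs.trans (integral_mono_of_nonneg
    (ae_of_all _ fun _ => abs_nonneg _) ((hV.integrable one_le_two).abs.const_mul _)
    (ae_of_all _ fun ω => ?_))
  have hcentered : |U ω - ∫ ω', U ω' ∂μ| ≤ 2 * M := (abs_sub _ _).trans (by linarith [hM ω])
  simpa only [abs_mul, mul_comm] using mul_le_mul_of_nonneg_right hcentered (abs_nonneg (V ω))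

theorem abs_covariance_le_integral_sq {U V : Ω → ℝ} (hU : MemLp U 2 μ) (hV : MemLp V 2 μ) :
    |cov[U, V; μ]| ≤ (∫ ω, U ω ^ 2 ∂μ + ∫ ω, V ω ^ 2 ∂μ) / 2 := by
  have hadd := variance_nonneg (U + V) μ
  have hsub := variance_nonneg (U - V) μ
  rw [variance_add hU hV] at hadd
  rw [variance_sub hU hV] at hsub
  have hvarU := variance_le_expectation_sq (μ := μ) hU.aestronglyMeasurable
  have hvarV := variance_le_expectation_sq (μ := μ) hV.aestronglyMeasurable
  simp only [Pi.pow_apply] at hvarU hvarV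
  exact abs_le.2 ⟨by linarith, by linarith⟩

theorem abs_covariance_le_of_approx {U V U' V' : Ω → ℝ} {M : ℝ} (hUM : ∀ ω, |U' ω| ≤ M)
    (hVM : ∀ ω, |V' ω| ≤ M) (hU : MemLp U 2 μ) (hV : MemLp V 2 μ) (hU' : MemLp U' 2 μ)
    (hV' : MemLp V' 2 μ) :
    |cov[U, V; μ]| ≤ |cov[U', V'; μ]| +
      2 * M * (∫ ω, |(U - U') ω| ∂μ + ∫ ω, |(V - V') ω| ∂μ) +
      (∫ ω, (U - U') ω ^ 2 ∂μ + ∫ ω, (V - V') ω ^ 2 ∂μ) / 2 := by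
  have hsplit : cov[U, V; μ] = cov[U', V'; μ] + cov[U', V - V'; μ] + cov[V', U - U'; μ] +
      cov[U - U', V - V'; μ] := by
    rw [covariance_comm V', covariance_sub_left hU hU' hV', covariance_sub_left hU hU' (hV.sub hV'),
      covariance_sub_right hU hV hV']
    ring
  rw [hsplit]
  refine (abs_add_le _ _).trans ?_
  linarith [abs_add_three cov[U', V'; μ] cov[U', V - V'; μ] cov[V', U - U'; μ],
    abs_covariance_le_mul_integral_abs hUM hU' (hV.sub hV'),
    abs_covariance_le_mul_integral_abs hVM hV' (hU.sub hU'),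
    abs_covariance_le_integral_sq (hU.sub hU') (hV.sub hV')]

/-- The α-mixing coefficient of the σ-fields `F` and `G` is at most `α`. -/
def StrongMixingLE (μ : Measure[m0] Ω) (F G : MeasurableSpace Ω) (α : ℝ) : Prop :=
  ∀ A B, MeasurableSet[F] A → MeasurableSet[G] B → |μ.real (A ∩ B) - μ.real A * μ.real B| ≤ α

theorem memLp_indicator_one {A : Set Ω} (hA : MeasurableSet A) :
    MemLp (A.indicator (1 : Ω → ℝ)) 2 μ :=
  memLp_indicator_const 2 hA 1 (Or.inr (measure_ne_top _ _))

theorem covariance_indicator_one_left {A : Set Ω} (hA : MeasurableSet A) {V : Ω → ℝ}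
    (hV : MemLp V 2 μ) :
    cov[A.indicator 1, V; μ] = ∫ ω in A, (V ω - ∫ ω', V ω' ∂μ) ∂μ := by
  rw [covariance_eq_integral_mul_sub (memLp_indicator_one hA) hV, ← integral_indicator hA]
  congr with ω
  by_cases hω : ω ∈ A <;> simp [hω]

/-- The extremal event is `{E[V - E V | F] ≥ 0}`. -/
theorem exists_abs_covariance_le_indicator {F : MeasurableSpace Ω} (hF : F ≤ m0) {U V : Ω → ℝ}
    (hU : Measurable[F] U) {M : ℝ} (hM : ∀ ω, |U ω| ≤ M) (hV : MemLp V 2 μ) :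
    ∃ A, MeasurableSet[F] A ∧ |cov[U, V; μ]| ≤ 2 * M * |cov[A.indicator 1, V; μ]| := by
  set W : Ω → ℝ := fun ω => V ω - ∫ ω', V ω' ∂μ with hW
  have hVi : Integrable V μ := hV.integrable one_le_two
  have hWi : Integrable W μ := hVi.sub (integrable_const _)
  have hU0 : Measurable[m0] U := hU.mono hF le_rfl
  have hU2 : MemLp U 2 μ := MemLp.of_bound hU0.aestronglyMeasurable M (ae_of_all _ hM)
  set g := μ[W|F] with hg
  have hgm : Measurable[F] g := stronglyMeasurable_condExp.measurable
  have hg0 : ∫ ω, g ω ∂μ = 0 := by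
    rw [hg, integral_condExp hF, hW, integral_sub hVi (integrable_const _)]
    simp
  have hA : MeasurableSet[F] {ω | 0 ≤ g ω} := hgm measurableSet_Ici
  have hcov : cov[U, V; μ] = ∫ ω, U ω * g ω ∂μ := by
    rw [covariance_eq_integral_mul_sub hU2 hV, ← integral_condExp hF]
    exact integral_congr_ae (condExp_mul_of_stronglyMeasurable_left hU.stronglyMeasurable
      (hWi.bdd_mul hU0.aestronglyMeasurable (ae_of_all _ hM)) hWi)
  have hindicator : ∫ ω in {ω | 0 ≤ g ω}, g ω ∂μ = cov[{ω | 0 ≤ g ω}.indicator 1, V; μ] := by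
    rw [setIntegral_condExp hF hWi hA, covariance_indicator_one_left (hF _ hA) hV]
  have hM0 : 0 ≤ M := by
    obtain ⟨ω⟩ := nonempty_of_isProbabilityMeasure μ
    exact (abs_nonneg _).trans (hM ω)
  refine ⟨_, hA, ?_⟩
  calc |cov[U, V; μ]| ≤ ∫ ω, M * |g ω| ∂μ := by
        rw [hcov]
        refine abs_integral_le_integral_abs.trans (integral_mono_of_nonneg
          (ae_of_all _ fun _ => abs_nonneg _) (integrable_condExp.abs.const_mul M)
          (ae_of_all _ fun ω => ?_))
        simpa only [abs_mul] using mul_le_mul_of_nonneg_right (hM ω) (abs_nonneg (g ω))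
    _ = 2 * M * cov[{ω | 0 ≤ g ω}.indicator 1, V; μ] := by
        rw [integral_const_mul, integral_abs_of_integral_eq_zero (hgm.mono hF le_rfl)
          integrable_condExp hg0, hindicator]
        ring
    _ ≤ _ := mul_le_mul_of_nonneg_left (le_abs_self _) (by positivity)

theorem covariance_indicator_indicator {A B : Set Ω} (hA : MeasurableSet A)
    (hB : MeasurableSet B) :
    cov[A.indicator 1, B.indicator 1; μ] = μ.real (A ∩ B) - μ.real A * μ.real B := by
  rw [covariance_eq_sub (memLp_indicator_one hA) (memLp_indicator_one hB),
    ← Set.inter_indicator_one, integral_indicator_one (hA.inter hB), integral_indicator_one hA,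
    integral_indicator_one hB]

theorem StrongMixingLE.abs_covariance_le_of_bounded {F G : MeasurableSpace Ω} {α : ℝ}
    (hα : StrongMixingLE μ F G α) (hF : F ≤ m0) (hG : G ≤ m0) {U V : Ω → ℝ}
    (hU : Measurable[F] U) (hV : Measurable[G] V) {M : ℝ} (hUM : ∀ ω, |U ω| ≤ M)
    (hVM : ∀ ω, |V ω| ≤ M) : |cov[U, V; μ]| ≤ 4 * α * M ^ 2 := by
  have hV2 : MemLp V 2 μ :=
    MemLp.of_bound (hV.mono hG le_rfl).aestronglyMeasurable M (ae_of_all _ hVM)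
  obtain ⟨A, hA, hUA⟩ := exists_abs_covariance_le_indicator hF hU hUM hV2
  obtain ⟨B, hB, hVB⟩ := exists_abs_covariance_le_indicator (V := A.indicator 1) hG hV hVM
    (memLp_indicator_one (μ := μ) (hF _ hA))
  have hM : 0 ≤ M := by
    obtain ⟨ω⟩ := nonempty_of_isProbabilityMeasure μ
    exact (abs_nonneg _).trans (hUM ω)
  rw [covariance_comm V, covariance_comm (B.indicator 1),
    covariance_indicator_indicator (hF _ hA) (hG _ hB)] at hVB
  calc |cov[U, V; μ]| ≤ 2 * M * (2 * M * α) :=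
        hUA.trans (mul_le_mul_of_nonneg_left
          (hVB.trans (mul_le_mul_of_nonneg_left (hα A B hA hB) (by positivity))) (by positivity))
    _ = 4 * α * M ^ 2 := by ring

theorem StrongMixingLE.abs_covariance_le_truncation {F G : MeasurableSpace Ω} {α : ℝ}
    (hα : StrongMixingLE μ F G α) (hF : F ≤ m0) (hG : G ≤ m0) {U V : Ω → ℝ}
    (hU : Measurable[F] U) (hV : Measurable[G] V) {q C : ℝ} (hq : 2 ≤ q)
    (hU2 : MemLp U 2 μ) (hV2 : MemLp V 2 μ)
    (hUq : Integrable (fun ω => |U ω| ^ q) μ) (hVq : Integrable (fun ω => |V ω| ^ q) μ)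
    (hUC : ∫ ω, |U ω| ^ q ∂μ ≤ C) (hVC : ∫ ω, |V ω| ^ q ∂μ ≤ C) {M : ℝ} (hM : 0 < M) :
    |cov[U, V; μ]| ≤ 4 * α * M ^ 2 + 5 * C * M ^ (2 - q) := by
  have hbound (Z : Ω → ℝ) (ω : Ω) : |truncation Z M ω| ≤ M :=
    (abs_truncation_le_bound Z M ω).trans_eq (abs_of_pos hM)
  have hmeas {H : MeasurableSpace Ω} {Z : Ω → ℝ} (hZ : Measurable[H] Z) :
      Measurable[H] (truncation Z M) :=
    (measurable_id.indicator measurableSet_Ioc).comp hZ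
  have hU1 : MemLp (truncation U M) 2 μ := hU2.aestronglyMeasurable.memLp_truncation
  have hV1 : MemLp (truncation V M) 2 μ := hV2.aestronglyMeasurable.memLp_truncation
  have hMpow : M * M ^ (1 - q) = M ^ (2 - q) := by
    nth_rewrite 1 [← Real.rpow_one M]
    rw [← Real.rpow_add hM]
    ring_nf
  have hmean {Z : Ω → ℝ} (hZq : Integrable (fun ω => |Z ω| ^ q) μ)
      (hZC : ∫ ω, |Z ω| ^ q ∂μ ≤ C) : M * ∫ ω, |(Z - truncation Z M) ω| ∂μ ≤ C * M ^ (2 - q) := by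
    have := integral_abs_sub_truncation_pow_le hZq hZC hM one_ne_zero (by norm_num; linarith)
    simp only [pow_one, Nat.cast_one] at this
    rw [← hMpow, mul_left_comm C]
    exact mul_le_mul_of_nonneg_left this hM.le
  have hsq {Z : Ω → ℝ} (hZq : Integrable (fun ω => |Z ω| ^ q) μ)
      (hZC : ∫ ω, |Z ω| ^ q ∂μ ≤ C) : ∫ ω, (Z - truncation Z M) ω ^ 2 ∂μ ≤ C * M ^ (2 - q) := by
    simpa using integral_abs_sub_truncation_pow_le hZq hZC hM two_ne_zero (by simpa using hq)
  refine (abs_covariance_le_of_approx (hbound U) (hbound V) hU2 hV2 hU1 hV1).trans ?_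
  linarith [hα.abs_covariance_le_of_bounded hF hG (hmeas hU) (hmeas hV) (hbound U) (hbound V),
    hmean hUq hUC, hmean hVq hVC, hsq hUq hUC, hsq hVq hVC]

/-- Davydov's inequality with a non-optimal constant. -/
theorem StrongMixingLE.abs_covariance_le_rpow {F G : MeasurableSpace Ω} {α : ℝ}
    (hα : StrongMixingLE μ F G α) (hF : F ≤ m0) (hG : G ≤ m0) {U V : Ω → ℝ}
    (hU : Measurable[F] U) (hV : Measurable[G] V) {q C : ℝ} (hq : 2 < q)
    (hUq : Integrable (fun ω => |U ω| ^ q) μ) (hVq : Integrable (fun ω => |V ω| ^ q) μ)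
    (hUC : ∫ ω, |U ω| ^ q ∂μ ≤ C) (hVC : ∫ ω, |V ω| ^ q ∂μ ≤ C) :
    |cov[U, V; μ]| ≤ (4 + 5 * C) * α ^ (1 - 2 / q) := by
  have hq0 : 0 < q := by linarith
  have hpos {a : ℝ} (ha : α ≤ a) (ha0 : 0 < a) :
      |cov[U, V; μ]| ≤ (4 + 5 * C) * a ^ (1 - 2 / q) := by
    have hM2 : a * (a ^ (-(1 / q))) ^ 2 = a ^ (1 - 2 / q) := by
      rw [← Real.rpow_natCast, ← Real.rpow_mul ha0.le]
      nth_rewrite 1 [← Real.rpow_one a]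
      rw [← Real.rpow_add ha0]
      congr 1; push_cast; ring
    have hMq : (a ^ (-(1 / q))) ^ (2 - q) = a ^ (1 - 2 / q) := by
      rw [← Real.rpow_mul ha0.le]
      congr 1; field_simp; ring
    have hαa : StrongMixingLE μ F G a := fun A B hA hB => (hα A B hA hB).trans ha
    have := hαa.abs_covariance_le_truncation hF hG hU hV hq.le
      (memLp_two_of_integrable_rpow (hU.mono hF le_rfl).aestronglyMeasurable hq.le hUq)
      (memLp_two_of_integrable_rpow (hV.mono hG le_rfl).aestronglyMeasurable hq.le hVq) hUq hVq hUC
      hVC (Real.rpow_pos_of_pos ha0 (-(1 / q)))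
    rw [mul_assoc 4, hM2, hMq] at this
    linarith
  have hα0 : 0 ≤ α :=
    (abs_nonneg _).trans (hα ∅ ∅ (@MeasurableSet.empty _ F) (@MeasurableSet.empty _ G))
  rcases hα0.eq_or_lt with rfl | hα0
  · have hexp : 0 < 1 - 2 / q := by rwa [sub_pos, div_lt_one hq0]
    have hlim := ((Real.continuousAt_rpow_const 0 _ (Or.inr hexp.le)).tendsto.mono_left
      (nhdsWithin_le_nhds (s := Set.Ioi (0 : ℝ)))).const_mul (4 + 5 * C)
    exact ge_of_tendsto hlim (eventually_mem_nhdsWithin.mono fun a ha => hpos (le_of_lt ha) ha)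
  · exact hpos le_rfl hα0

end Mixing

/-! ### Mean square bounds -/

section OuterMean

variable {Ω : Type*} [MeasurableSpace Ω] {μ : Measure Ω}

/-- The outer expectation of `f` is at most `c`: some integrable function that dominates `f`
pointwise has mean at most `c`. Estimators built from eigenvectors are not assumed to be
measurable, so their mean square errors are bounded in this sense. -/
def OuterMeanLE (μ : Measure Ω) (f : Ω → ℝ) (c : ℝ) : Prop :=
  ∃ R : Ω → ℝ, Integrable R μ ∧ (∀ ω, f ω ≤ R ω) ∧ ∫ ω, R ω ∂μ ≤ c

namespace OuterMeanLE

variable {f g : Ω → ℝ} {a b c : ℝ}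

theorem of_integrable (hf : Integrable f μ) (hc : ∫ ω, f ω ∂μ ≤ c) : OuterMeanLE μ f c :=
  ⟨f, hf, fun _ => le_rfl, hc⟩

theorem mono (hg : OuterMeanLE μ g b) (hfg : ∀ ω, f ω ≤ g ω) (hbc : b ≤ c) :
    OuterMeanLE μ f c :=
  let ⟨R, hR, hgR, hRb⟩ := hg
  ⟨R, hR, fun ω => (hfg ω).trans (hgR ω), hRb.trans hbc⟩

theorem add (hf : OuterMeanLE μ f a) (hg : OuterMeanLE μ g b) :
    OuterMeanLE μ (fun ω => f ω + g ω) (a + b) :=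
  let ⟨R, hR, hfR, hRa⟩ := hf
  let ⟨S, hS, hgS, hSb⟩ := hg
  ⟨fun ω => R ω + S ω, hR.add hS, fun ω => add_le_add (hfR ω) (hgS ω),
    (integral_add hR hS).trans_le (add_le_add hRa hSb)⟩

theorem const_mul (hf : OuterMeanLE μ f a) (hc : 0 ≤ c) :
    OuterMeanLE μ (fun ω => c * f ω) (c * a) :=
  let ⟨R, hR, hfR, hRa⟩ := hf
  ⟨fun ω => c * R ω, hR.const_mul c, fun ω => mul_le_mul_of_nonneg_left (hfR ω) hc,
    (integral_const_mul c R).trans_le (mul_le_mul_of_nonneg_left hRa hc)⟩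

theorem finset_sum {ι : Type*} {s : Finset ι} {f : ι → Ω → ℝ} {c : ι → ℝ}
    (h : ∀ i ∈ s, OuterMeanLE μ (f i) (c i)) :
    OuterMeanLE μ (fun ω => ∑ i ∈ s, f i ω) (∑ i ∈ s, c i) := by
  classical
  induction s using Finset.induction_on with
  | empty => exact of_integrable (by simp) (by simp)
  | insert i s hi ih =>
    simp only [Finset.sum_insert hi]
    exact (h i (Finset.mem_insert_self i s)).add
      (ih fun j hj => h j (Finset.mem_insert_of_mem hj))

theorem frobenius_norm_sq {ι κ : Type*} [Fintype ι] [Fintype κ] {R : Ω → Matrix ι κ ℝ}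
    {c : ι → κ → ℝ} (h : ∀ i j, OuterMeanLE μ (fun ω => R ω i j ^ 2) (c i j)) :
    OuterMeanLE μ (fun ω => ‖R ω‖ ^ 2) (∑ i, ∑ j, c i j) := by
  simp only [SpatialFactor.frobenius_norm_sq]
  exact finset_sum fun i _ => finset_sum fun j _ => h i j

theorem measure_lt_abs_le [IsFiniteMeasure μ] (hf : OuterMeanLE μ (fun ω => f ω ^ 2) c)
    (ha : 0 < a) : μ {ω | a < |f ω|} ≤ ENNReal.ofReal (c / a ^ 2) := by
  obtain ⟨R, hR, hfR, hRc⟩ := hf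
  have hR0 : 0 ≤ᵐ[μ] R := ae_of_all _ fun ω => (sq_nonneg _).trans (hfR ω)
  have hmarkov : μ.real {ω | a ^ 2 ≤ R ω} ≤ c / a ^ 2 := by
    rw [le_div_iff₀' (by positivity)]
    exact (mul_meas_ge_le_integral_of_nonneg hR0 hR (a ^ 2)).trans hRc
  have hsubset : {ω | a < |f ω|} ⊆ {ω | a ^ 2 ≤ R ω} := fun ω hω =>
    (sq_le_sq.2 ((abs_of_pos ha).trans_le hω.le)).trans (hfR ω)
  calc μ {ω | a < |f ω|} ≤ μ {ω | a ^ 2 ≤ R ω} := measure_mono hsubset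
    _ = ENNReal.ofReal (μ.real {ω | a ^ 2 ≤ R ω}) := (ofReal_measureReal).symm
    _ ≤ ENNReal.ofReal (c / a ^ 2) := ENNReal.ofReal_le_ofReal hmarkov

end OuterMeanLE

theorem isBigOp_of_outerMeanLE_sq [IsFiniteMeasure μ] {D : ℕ → Ω → ℝ} {c ρ : ℕ → ℝ}
    (hD : ∀ᶠ N in atTop, OuterMeanLE μ (fun ω => D N ω ^ 2) (c N))
    (hc : c =O[atTop] fun N => ρ N ^ 2) (hρ : ∀ᶠ N in atTop, 0 < ρ N) : IsBigOp μ D ρ := by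
  intro η hη
  obtain ⟨C, hC, hcC⟩ := hc.exists_pos
  have hCη : C / (C / η + 1) ^ 2 ≤ η := by
    have hpos : 0 < C / η := by positivity
    rw [div_le_iff₀ (by positivity)]
    calc C = η * (C / η) := by field_simp
      _ ≤ η * (C / η + 1) ^ 2 := by gcongr; nlinarith
  refine ⟨C / η + 1, by positivity, ?_⟩
  filter_upwards [hD, hcC.bound, hρ] with N hDN hcN hρN
  refine (hDN.measure_lt_abs_le (by positivity)).trans (ENNReal.ofReal_le_ofReal ?_)
  have hcN' : c N ≤ C * ρ N ^ 2 := by simpa using (Real.le_norm_self _).trans hcN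
  calc c N / ((C / η + 1) * ρ N) ^ 2 ≤ C * ρ N ^ 2 / ((C / η + 1) * ρ N) ^ 2 := by gcongr
    _ = C / (C / η + 1) ^ 2 := by field_simp
    _ ≤ η := hCη

theorem sum_natDist_le_two_mul_tsum {c : ℕ → ℝ} (h0 : ∀ h, 0 ≤ c h) (hc : Summable c)
    (s : Finset ℕ) (t : ℕ) : ∑ k ∈ s, c (Nat.dist t k) ≤ 2 * ∑' h, c h := by
  classical
  have hinj (s' : Finset ℕ) (hs' : Set.InjOn (Nat.dist t) s') :
      ∑ k ∈ s', c (Nat.dist t k) ≤ ∑' h, c h := by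
    rw [← Finset.sum_image (f := c) hs']
    exact hc.sum_le_tsum _ fun h _ => h0 h
  rw [← Finset.sum_filter_add_sum_filter_not s (fun k => k ≤ t), two_mul]
  refine add_le_add (hinj _ fun a ha b hb hab => ?_) (hinj _ fun a ha b hb hab => ?_) <;>
  · simp only [Finset.coe_filter, Set.mem_ofPred_eq] at ha hb
    simp only [Nat.dist] at hab
    omega

theorem outerMeanLE_sq_average {Z : ℕ → Ω → ℝ} (hZ : ∀ t, MemLp (Z t) 2 μ) {c : ℕ → ℝ}
    (h0 : ∀ h, 0 ≤ c h) (hc : Summable c)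
    (hcov : ∀ t h, ∫ ω, Z t ω * Z (t + h) ω ∂μ ≤ c h) (T : ℕ) :
    OuterMeanLE μ (fun ω => ((T : ℝ)⁻¹ * ∑ t ∈ Finset.Icc 1 T, Z t ω) ^ 2)
      (2 * (∑' h, c h) / T) := by
  have hint (s t : ℕ) : Integrable (fun ω => Z s ω * Z t ω) μ := (hZ s).integrable_mul (hZ t)
  have hdist (s t : ℕ) : ∫ ω, Z s ω * Z t ω ∂μ ≤ c (Nat.dist s t) := by
    rcases le_total s t with hst | hst <;> obtain ⟨h, rfl⟩ := Nat.exists_eq_add_of_le hst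
    · simpa [Nat.dist] using hcov s h
    · simpa [Nat.dist, mul_comm] using hcov t h
  have hpairs : OuterMeanLE μ
      (fun ω => ∑ s ∈ Finset.Icc 1 T, ∑ t ∈ Finset.Icc 1 T, Z s ω * Z t ω)
      (∑ s ∈ Finset.Icc 1 T, ∑ t ∈ Finset.Icc 1 T, c (Nat.dist s t)) :=
    .finset_sum fun s _ => .finset_sum fun t _ => .of_integrable (hint s t) (hdist s t)
  refine (hpairs.const_mul (sq_nonneg (T : ℝ)⁻¹)).mono (fun ω => ?_) ?_
  · rw [mul_pow, sq (∑ t ∈ _, _), Finset.sum_mul_sum]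
  · calc (T : ℝ)⁻¹ ^ 2 * ∑ s ∈ Finset.Icc 1 T, ∑ t ∈ Finset.Icc 1 T, c (Nat.dist s t)
        ≤ (T : ℝ)⁻¹ ^ 2 * ∑ _s ∈ Finset.Icc 1 T, 2 * ∑' h, c h := by
          gcongr with s
          exact sum_natDist_le_two_mul_tsum h0 hc _ s
      _ = 2 * (∑' h, c h) / T := by
          rw [Finset.sum_const, Nat.card_Icc, add_tsub_cancel_right, nsmul_eq_mul]
          rcases eq_or_ne (T : ℝ) 0 with hT | hT
          · simp [hT]
          · field_simp

theorem outerMeanLE_sq_average_of_orthogonal {Z : ℕ → Ω → ℝ} (hZ : ∀ t, MemLp (Z t) 2 μ) {K : ℝ}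
    (hvar : ∀ t, ∫ ω, Z t ω ^ 2 ∂μ ≤ K) (horth : ∀ s t, s ≠ t → ∫ ω, Z s ω * Z t ω ∂μ = 0)
    (T : ℕ) :
    OuterMeanLE μ (fun ω => ((T : ℝ)⁻¹ * ∑ t ∈ Finset.Icc 1 T, Z t ω) ^ 2) (2 * K / T) := by
  have hK : 0 ≤ K := (integral_nonneg fun _ => sq_nonneg _).trans (hvar 0)
  have hsum : HasSum (fun h : ℕ => if h = 0 then K else 0) K := hasSum_ite_eq 0 K
  rw [← hsum.tsum_eq]
  refine outerMeanLE_sq_average hZ (fun h => by split_ifs <;> simp [hK]) hsum.summable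
    (fun t h => ?_) T
  split_ifs with hh
  · simpa [hh, sq] using hvar t
  · exact (horth t (t + h) (by omega)).le

end OuterMean

/-! ### Products of coordinates of an α-mixing process -/

section MixingProcess

theorem abs_mul_rpow_le {q : ℝ} (x y : ℝ) :
    |x * y| ^ q ≤ (|x| ^ (2 * q) + |y| ^ (2 * q)) / 2 := by
  have hsq (z : ℝ) : |z| ^ (2 * q) = (|z| ^ q) ^ 2 := by
    rw [mul_comm, Real.rpow_mul (abs_nonneg z), Real.rpow_two]
  rw [hsq, hsq, abs_mul, Real.mul_rpow (abs_nonneg x) (abs_nonneg y)]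
  linarith [two_mul_le_add_sq (|x| ^ q) (|y| ^ q)]

theorem integrable_abs_mul_rpow {Ω : Type*} [MeasurableSpace Ω] {μ : Measure Ω} {U V : Ω → ℝ}
    {q : ℝ} (hU : Measurable U) (hV : Measurable V)
    (hUq : Integrable (fun ω => |U ω| ^ (2 * q)) μ)
    (hVq : Integrable (fun ω => |V ω| ^ (2 * q)) μ) :
    Integrable (fun ω => |U ω * V ω| ^ q) μ := by
  refine ((hUq.add hVq).div_const 2).mono' ((hU.mul hV).abs.pow_const q).aestronglyMeasurable
    (ae_of_all _ fun ω => ?_)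
  rw [Real.norm_of_nonneg (by positivity)]
  exact abs_mul_rpow_le _ _

theorem integral_abs_mul_rpow_le {Ω : Type*} [MeasurableSpace Ω] {μ : Measure Ω} {U V : Ω → ℝ}
    {q C : ℝ} (hUq : Integrable (fun ω => |U ω| ^ (2 * q)) μ)
    (hVq : Integrable (fun ω => |V ω| ^ (2 * q)) μ) (hUC : ∫ ω, |U ω| ^ (2 * q) ∂μ ≤ C)
    (hVC : ∫ ω, |V ω| ^ (2 * q) ∂μ ≤ C) : ∫ ω, |U ω * V ω| ^ q ∂μ ≤ C :=
  calc ∫ ω, |U ω * V ω| ^ q ∂μ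
      ≤ ∫ ω, (|U ω| ^ (2 * q) + |V ω| ^ (2 * q)) / 2 ∂μ :=
        integral_mono_of_nonneg (ae_of_all _ fun _ => by positivity)
          ((hUq.add hVq).div_const 2) (ae_of_all _ fun _ => abs_mul_rpow_le _ _)
    _ = (∫ ω, |U ω| ^ (2 * q) ∂μ + ∫ ω, |V ω| ^ (2 * q) ∂μ) / 2 := by
        rw [integral_div, integral_add hUq hVq]
    _ ≤ C := by linarith

variable {Ω : Type*} {d r : ℕ} {X : ℤ → Ω → Matrix (Fin d) (Fin r) ℝ}

theorem measurable_sigmaField {I : Set ℤ} {t : ℤ} (ht : t ∈ I) (k : Fin d × Fin r) :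
    Measurable[sigmaField X I] fun ω => X t ω k.1 k.2 := by
  have hvec : Measurable[sigmaField X I] fun ω (k : Fin d × Fin r) => X t ω k.1 k.2 :=
    Measurable.of_comap_le (le_iSup₂_of_le t ht le_rfl)
  exact (measurable_pi_apply k).comp hvec

variable [m0 : MeasurableSpace Ω] {μ : Measure Ω}

theorem sigmaField_le (hX : ∀ t i j, Measurable fun ω => X t ω i j) (I : Set ℤ) :
    sigmaField X I ≤ m0 :=
  iSup₂_le fun t _ => Measurable.comap_le (measurable_pi_lambda _ fun k => hX t k.1 k.2)

theorem alphaMixing_nonneg (h : ℕ) : 0 ≤ alphaMixing μ X h :=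
  Real.sSup_nonneg (by rintro x ⟨_, A, B, _, _, rfl⟩; exact abs_nonneg _)

variable [IsProbabilityMeasure μ]

theorem abs_measureReal_inter_sub_le_one (A B : Set Ω) :
    |μ.real (A ∩ B) - μ.real A * μ.real B| ≤ 1 :=
  abs_sub_le_of_nonneg_of_le measureReal_nonneg measureReal_le_one (by positivity)
    (mul_le_one₀ measureReal_le_one measureReal_nonneg measureReal_le_one)

theorem strongMixingLE_alphaMixing (τ : ℤ) (h : ℕ) :
    StrongMixingLE μ (sigmaField X (Set.Iic τ)) (sigmaField X (Set.Ici (τ + h)))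
      (alphaMixing μ X h) := fun A B hA hB =>
  le_csSup ⟨1, by rintro x ⟨_, A, B, _, _, rfl⟩; exact abs_measureReal_inter_sub_le_one A B⟩
    ⟨τ, A, B, hA, hB, rfl⟩

theorem abs_covariance_mul_le_alphaMixing {q C : ℝ} (hX : ∀ t i j, Measurable fun ω => X t ω i j)
    (hq : 2 < q) (hXq : ∀ t i j, Integrable (fun ω => |X t ω i j| ^ (2 * q)) μ)
    (hXC : ∀ t i j, ∫ ω, |X t ω i j| ^ (2 * q) ∂μ ≤ C) (k l : Fin d × Fin r) (t : ℤ) (h : ℕ) :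
    |cov[fun ω => X t ω k.1 k.2 * X t ω l.1 l.2,
        fun ω => X (t + h) ω k.1 k.2 * X (t + h) ω l.1 l.2; μ]| ≤
      (4 + 5 * C) * alphaMixing μ X h ^ (1 - 2 / q) :=
  (strongMixingLE_alphaMixing t h).abs_covariance_le_rpow (sigmaField_le hX _) (sigmaField_le hX _)
    ((measurable_sigmaField Set.self_mem_Iic k).mul (measurable_sigmaField Set.self_mem_Iic l))
    ((measurable_sigmaField Set.self_mem_Ici k).mul (measurable_sigmaField Set.self_mem_Ici l)) hq
    (integrable_abs_mul_rpow (hX ..) (hX ..) (hXq ..) (hXq ..))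
    (integrable_abs_mul_rpow (hX ..) (hX ..) (hXq ..) (hXq ..))
    (integral_abs_mul_rpow_le (hXq ..) (hXq ..) (hXC ..) (hXC ..))
    (integral_abs_mul_rpow_le (hXq ..) (hXq ..) (hXC ..) (hXC ..))

end MixingProcess

/-! ### Time averages of products of factors and noise -/

namespace Model

variable {Ω : Type*} {d r : ℕ} {𝒮 : Set (EuclideanSpace ℝ (Fin 2))} {m : Model Ω d r 𝒮} {q : ℝ}

theorem Design.ne_of_mem (hdesign : m.Design) {N : ℕ} (u : m.S₁ N) (v : m.S₂ N) :
    (u : 𝒮) ≠ v := fun h =>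
  Finset.disjoint_left.1 (hdesign.disjoint N) u.2 (h ▸ v.2)

variable [MeasurableSpace Ω] {μ : Measure Ω}

/-- The moments of order `2q` of the entries of the factor are bounded uniformly in time. -/
def BoundedMoments (m : Model Ω d r 𝒮) (μ : Measure Ω) (q : ℝ) : Prop :=
  ∃ C : ℝ, 0 < C ∧ ∀ t i j, Integrable (fun ω => |m.X t ω i j| ^ (2 * q)) μ ∧
    ∫ ω, |m.X t ω i j| ^ (2 * q) ∂μ ≤ C

/-- The covariance matrix `Σ_f(0)` of `vec(X_t)`, written as a matrix of second moments since the
factor is centered. -/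
def factorCov (m : Model Ω d r 𝒮) (μ : Measure Ω) :
    Matrix (Fin d × Fin r) (Fin d × Fin r) ℝ :=
  Matrix.of fun k l => ∫ ω, m.X 0 ω k.1 k.2 * m.X 0 ω l.1 l.2 ∂μ

theorem MixingCondition.integral_factor_mul (hmix : m.MixingCondition μ q) (t : ℤ)
    (k l : Fin d × Fin r) :
    ∫ ω, m.X t ω k.1 k.2 * m.X t ω l.1 l.2 ∂μ = m.factorCov μ k l := by
  have hmeas (s : ℤ) : Measurable fun ω (t : ℤ) (k : Fin d × Fin r) => m.X (t + s) ω k.1 k.2 :=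
    measurable_pi_lambda _ fun t => measurable_pi_lambda _ fun k => hmix.measurable _ _ _
  have hlaw (s : ℤ) : ∫ x : ℤ → Fin d × Fin r → ℝ, x 0 k * x 0 l
      ∂μ.map (fun ω t k => m.X (t + s) ω k.1 k.2) =
        ∫ ω, m.X (0 + s) ω k.1 k.2 * m.X (0 + s) ω l.1 l.2 ∂μ :=
    integral_map (hmeas s).aemeasurable
      (by fun_prop : Measurable fun x : ℤ → Fin d × Fin r → ℝ => x 0 k * x 0 l).aestronglyMeasurable
  have hshift := hlaw t
  have horigin := hlaw 0
  simp only [zero_add, add_zero] at hshift horigin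
  rw [← hshift, hmix.stationary t, horigin, factorCov, Matrix.of_apply]

theorem NuggetNoise.integral_noise_mul_noise (hnoise : m.NuggetNoise μ) {N : ℕ} (t : ℤ) {u v : 𝒮}
    (huv : u ≠ v) (i j : Fin (m.p N)) : ∫ ω, m.ε N t ω u i * m.ε N t ω v j ∂μ = 0 := by
  simpa [covariance, hnoise.mean_zero] using hnoise.uncorrelated N t u v huv i j

theorem NuggetNoise.integral_noise_mul_noise_of_ne (hnoise : m.NuggetNoise μ) {N : ℕ} {s t : ℤ}
    (hst : s ≠ t) (u : 𝒮) (i : Fin (m.p N)) : ∫ ω, m.ε N s ω u i * m.ε N t ω u i ∂μ = 0 := by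
  have hindep : IndepFun (fun ω => m.ε N s ω u i) (fun ω => m.ε N t ω u i) μ :=
    ((hnoise.indep_time N).indepFun hst).comp (measurable_pi_apply (u, i))
      (measurable_pi_apply (u, i))
  rw [hindep.integral_fun_mul_eq_mul_integral
    (hnoise.measurable N s u i).aestronglyMeasurable
    (hnoise.measurable N t u i).aestronglyMeasurable, hnoise.mean_zero, zero_mul]

theorem exists_outerMeanLE_sq_average_noise_mul_noise (hnoise : m.NuggetNoise μ)
    (hdesign : m.Design) :
    ∃ K : ℝ, ∀ (N : ℕ) (u : m.S₁ N) (v : m.S₂ N) (i j : Fin (m.p N)) (T : ℕ),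
      OuterMeanLE μ (fun ω =>
        ((T : ℝ)⁻¹ * ∑ t ∈ Finset.Icc 1 T, m.ε N t ω u i * m.ε N t ω v j) ^ 2) (K / T) := by
  obtain ⟨K, -, hK⟩ := hnoise.bounded
  refine ⟨2 * K, fun N u v i j T => ?_⟩
  have hprod (t : ℤ) := hK N t u u.2 v v.2 i j
  simp only [← mul_pow] at hprod
  have hmemLp (t : ℤ) : MemLp (fun ω => m.ε N t ω u i * m.ε N t ω v j) 2 μ :=
    (memLp_two_iff_integrable_sq ((hnoise.measurable N t u i).mul
      (hnoise.measurable N t v j)).aestronglyMeasurable).2 (hprod t).1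
  refine outerMeanLE_sq_average_of_orthogonal (fun t => hmemLp t) (fun t => (hprod t).2)
    (fun s t hst => ?_) T
  have hmeas : Measurable fun x : 𝒮 × Fin (m.p N) → ℝ => x (u, i) * x (v, j) := by fun_prop
  have hindep : IndepFun (fun ω => m.ε N s ω u i * m.ε N s ω v j)
      (fun ω => m.ε N t ω u i * m.ε N t ω v j) μ :=
    ((hnoise.indep_time N).indepFun (Nat.cast_injective.ne hst)).comp hmeas hmeas
  rw [hindep.integral_fun_mul_eq_mul_integral (hmemLp s).aestronglyMeasurable
    (hmemLp t).aestronglyMeasurable,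
    hnoise.integral_noise_mul_noise _ (hdesign.ne_of_mem u v), zero_mul]

theorem indepFun_factor_mul_noise_mul (hnoise : m.NuggetNoise μ) {N : ℕ} (k : Fin d × Fin r)
    (u : 𝒮) (i : Fin (m.p N)) (s t : ℤ) :
    IndepFun (fun ω => m.X s ω k.1 k.2 * m.X t ω k.1 k.2)
      (fun ω => m.ε N s ω u i * m.ε N t ω u i) μ :=
  (hnoise.indep_factor N).comp (φ := fun x : ℤ → Fin d × Fin r → ℝ => x s k * x t k)
    (ψ := fun x : ℤ → 𝒮 × Fin (m.p N) → ℝ => x s (u, i) * x t (u, i)) (by fun_prop) (by fun_prop)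

variable [IsProbabilityMeasure μ]

theorem MixingCondition.memLp_factor (hmix : m.MixingCondition μ q) (hmom : m.BoundedMoments μ q)
    (t : ℤ) (k : Fin d × Fin r) : MemLp (fun ω => m.X t ω k.1 k.2) 2 μ :=
  let ⟨_, _, hX⟩ := hmom
  memLp_two_of_integrable_rpow (hmix.measurable ..).aestronglyMeasurable
    (by linarith [hmix.two_lt]) (hX t k.1 k.2).1

theorem MixingCondition.memLp_factor_mul (hmix : m.MixingCondition μ q)
    (hmom : m.BoundedMoments μ q) (t : ℤ) (k l : Fin d × Fin r) :
    MemLp (fun ω => m.X t ω k.1 k.2 * m.X t ω l.1 l.2) 2 μ :=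
  let ⟨_, _, hX⟩ := hmom
  memLp_two_of_integrable_rpow ((hmix.measurable ..).mul (hmix.measurable ..)).aestronglyMeasurable
    hmix.two_lt.le (integrable_abs_mul_rpow (hmix.measurable ..) (hmix.measurable ..)
      (hX ..).1 (hX ..).1)

theorem exists_outerMeanLE_sq_average_factor_mul_factor (hmix : m.MixingCondition μ q)
    (hmom : m.BoundedMoments μ q) :
    ∃ K : ℝ, ∀ (k l : Fin d × Fin r) (T : ℕ),
      OuterMeanLE μ (fun ω => ((T : ℝ)⁻¹ * ∑ t ∈ Finset.Icc 1 T,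
        (m.X t ω k.1 k.2 * m.X t ω l.1 l.2 - m.factorCov μ k l)) ^ 2) (K / T) := by
  have hprod := hmix.memLp_factor_mul hmom
  obtain ⟨C, hC, hX⟩ := hmom
  have hsummable : Summable fun h => alphaMixing μ m.X h ^ (1 - 2 / q) :=
    (summable_nat_add_iff (f := fun h => alphaMixing μ m.X h ^ (1 - 2 / q)) 1).1 hmix.mixing
  refine ⟨2 * ∑' h, (4 + 5 * C) * alphaMixing μ m.X h ^ (1 - 2 / q), fun k l T => ?_⟩
  refine outerMeanLE_sq_average
    (Z := fun (t : ℕ) ω => m.X t ω k.1 k.2 * m.X t ω l.1 l.2 - m.factorCov μ k l)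
    (fun t => (hprod t k l).sub (memLp_const _))
    (fun h => mul_nonneg (by positivity) (Real.rpow_nonneg (alphaMixing_nonneg h) _))
    (hsummable.mul_left _) (fun t h => ?_) T
  have hcov := (le_abs_self _).trans (abs_covariance_mul_le_alphaMixing hmix.measurable hmix.two_lt
    (fun t i j => (hX t i j).1) (fun t i j => (hX t i j).2) k l t h)
  simpa only [covariance, hmix.integral_factor_mul, Nat.cast_add] using hcov

theorem exists_outerMeanLE_sq_average_factor_mul_noise (hmix : m.MixingCondition μ q)
    (hmom : m.BoundedMoments μ q) (hnoise : m.NuggetNoise μ) :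
    ∃ K : ℝ, ∀ (N : ℕ) (k : Fin d × Fin r), ∀ u ∈ (m.S₁ N : Set 𝒮) ∪ m.S₂ N,
      ∀ (i : Fin (m.p N)) (T : ℕ), OuterMeanLE μ (fun ω =>
        ((T : ℝ)⁻¹ * ∑ t ∈ Finset.Icc 1 T, m.X t ω k.1 k.2 * m.ε N t ω u i) ^ 2)
        (m.factorCov μ k k * K / T) := by
  obtain ⟨K, hK, -⟩ := hnoise.bounded
  refine ⟨2 * K, fun N k u hu i T => ?_⟩
  have hint (s t : ℤ) : Integrable (fun ω => m.X s ω k.1 k.2 * m.X t ω k.1 k.2) μ :=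
    (hmix.memLp_factor hmom s k).integrable_mul (hmix.memLp_factor hmom t k)
  have hint' (s t : ℤ) : Integrable (fun ω => m.ε N s ω u i * m.ε N t ω u i) μ :=
    (hnoise.memLp N s u i).integrable_mul (hnoise.memLp N t u i)
  have hindep := indepFun_factor_mul_noise_mul hnoise k u i
  have hmemLp (t : ℤ) : MemLp (fun ω => m.X t ω k.1 k.2 * m.ε N t ω u i) 2 μ := by
    refine (memLp_two_iff_integrable_sq ((hmix.measurable t k.1 k.2).mul
      (hnoise.measurable N t u i)).aestronglyMeasurable).2 ?_
    simpa only [Pi.mul_def, ← sq, ← mul_pow] using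
      (hindep t t).integrable_mul (hint t t) (hint' t t)
  have hfactorize (s t : ℤ) :
      ∫ ω, (m.X s ω k.1 k.2 * m.ε N s ω u i) * (m.X t ω k.1 k.2 * m.ε N t ω u i) ∂μ =
        (∫ ω, m.X s ω k.1 k.2 * m.X t ω k.1 k.2 ∂μ) * ∫ ω, m.ε N s ω u i * m.ε N t ω u i ∂μ := by
    simp only [mul_mul_mul_comm (m.X s _ _ _)]
    exact (hindep s t).integral_fun_mul_eq_mul_integral (hint s t).aestronglyMeasurable
      (hint' s t).aestronglyMeasurable
  have hcov0 : 0 ≤ m.factorCov μ k k := integral_nonneg fun _ => mul_self_nonneg _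
  refine (outerMeanLE_sq_average_of_orthogonal (K := m.factorCov μ k k * K) (fun t => hmemLp t)
    (fun t => ?_) (fun s t hst => ?_) T).mono (fun _ => le_rfl) (by rw [mul_left_comm])
  · have hsq := hK N t u hu i
    simp only [sq] at hsq ⊢
    rw [hfactorize, hmix.integral_factor_mul]
    gcongr
  · rw [hfactorize, hnoise.integral_noise_mul_noise_of_ne (Nat.cast_injective.ne hst), mul_zero]

end Model

/-! ### The sample cross-covariance -/

section SampleMoment

variable {ι κ η θ : Type*}

/-- The uncentered sample cross-moment `T⁻¹ ∑_{t=1}^T x_t y_t'` of two series of vectors. -/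
def sampleMoment (T : ℕ) (x : ℕ → ι → ℝ) (y : ℕ → κ → ℝ) : Matrix ι κ ℝ :=
  (T : ℝ)⁻¹ • ∑ t ∈ Finset.Icc 1 T, Matrix.vecMulVec (x t) (y t)

theorem sampleMoment_apply (T : ℕ) (x : ℕ → ι → ℝ) (y : ℕ → κ → ℝ) (i : ι) (j : κ) :
    sampleMoment T x y i j = (T : ℝ)⁻¹ * ∑ t ∈ Finset.Icc 1 T, x t i * y t j := by
  simp only [sampleMoment, Matrix.smul_apply, Matrix.sum_apply, Matrix.vecMulVec_apply,
    smul_eq_mul]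

theorem sampleMoment_transpose (T : ℕ) (x : ℕ → ι → ℝ) (y : ℕ → κ → ℝ) :
    (sampleMoment T x y)ᵀ = sampleMoment T y x := by
  simp only [sampleMoment, Matrix.transpose_smul, Matrix.transpose_sum,
    Matrix.transpose_vecMulVec]

theorem sampleMoment_sub_apply {T : ℕ} (hT : 0 < T) (x : ℕ → ι → ℝ) (y : ℕ → κ → ℝ)
    (C : Matrix ι κ ℝ) (i : ι) (j : κ) :
    (sampleMoment T x y - C) i j =
      (T : ℝ)⁻¹ * ∑ t ∈ Finset.Icc 1 T, (x t i * y t j - C i j) := by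
  rw [Matrix.sub_apply, sampleMoment_apply, Finset.sum_sub_distrib, Finset.sum_const,
    Nat.card_Icc, Nat.add_sub_cancel, nsmul_eq_mul]
  field_simp

variable [Fintype η] [Fintype θ]

theorem sampleMoment_mulVec_add (T : ℕ) (A : Matrix ι η ℝ) (B : Matrix κ θ ℝ)
    (f : ℕ → η → ℝ) (g : ℕ → θ → ℝ) (e : ℕ → ι → ℝ) (e' : ℕ → κ → ℝ) :
    sampleMoment T (fun t => A *ᵥ f t + e t) (fun t => B *ᵥ g t + e' t) =
      A * sampleMoment T f g * Bᵀ + A * sampleMoment T f e' + sampleMoment T e g * Bᵀ +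
        sampleMoment T e e' := by
  simp only [sampleMoment, Matrix.mul_smul, Matrix.smul_mul, Matrix.mul_sum, Matrix.sum_mul,
    Matrix.mul_vecMulVec, Matrix.vecMulVec_mul, Matrix.vecMul_transpose, ← smul_add,
    ← Finset.sum_add_distrib, Matrix.add_vecMulVec, Matrix.vecMulVec_add]
  congr! 2
  abel

theorem norm_add_four_sq_le {E : Type*} [SeminormedAddCommGroup E] (a b c d : E) :
    ‖a + b + c + d‖ ^ 2 ≤ 4 * (‖a‖ ^ 2 + ‖b‖ ^ 2 + ‖c‖ ^ 2 + ‖d‖ ^ 2) := by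
  have hsum := pow_le_pow_left₀ (norm_nonneg _) (norm_add₄_le (a := a) (b := b) (c := c) (d := d)) 2
  nlinarith [sq_nonneg (‖a‖ - ‖b‖), sq_nonneg (‖a‖ - ‖c‖), sq_nonneg (‖a‖ - ‖d‖),
    sq_nonneg (‖b‖ - ‖c‖), sq_nonneg (‖b‖ - ‖d‖), sq_nonneg (‖c‖ - ‖d‖)]

variable [Fintype ι] [Fintype κ]

theorem norm_sampleMoment_mulVec_add_sub_sq_le (T : ℕ) (A : Matrix ι η ℝ) (B : Matrix κ θ ℝ)
    (C : Matrix η θ ℝ) (f : ℕ → η → ℝ) (g : ℕ → θ → ℝ) (e : ℕ → ι → ℝ) (e' : ℕ → κ → ℝ) :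
    ‖sampleMoment T (fun t => A *ᵥ f t + e t) (fun t => B *ᵥ g t + e' t) - A * C * Bᵀ‖ ^ 2 ≤
      4 * (‖A‖ ^ 2 * ‖B‖ ^ 2 * ‖sampleMoment T f g - C‖ ^ 2 +
        ‖A‖ ^ 2 * ‖sampleMoment T f e'‖ ^ 2 + ‖B‖ ^ 2 * ‖sampleMoment T g e‖ ^ 2 +
        ‖sampleMoment T e e'‖ ^ 2) := by
  have hdecomp : sampleMoment T (fun t => A *ᵥ f t + e t) (fun t => B *ᵥ g t + e' t) -
      A * C * Bᵀ = A * (sampleMoment T f g - C) * Bᵀ + A * sampleMoment T f e' +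
        sampleMoment T e g * Bᵀ + sampleMoment T e e' := by
    rw [sampleMoment_mulVec_add, Matrix.mul_sub, Matrix.sub_mul]
    abel
  have hsignal : ‖A * (sampleMoment T f g - C) * Bᵀ‖ ≤ ‖A‖ * ‖B‖ * ‖sampleMoment T f g - C‖ :=
    calc ‖A * (sampleMoment T f g - C) * Bᵀ‖
        ≤ ‖A * (sampleMoment T f g - C)‖ * ‖Bᵀ‖ := Matrix.frobenius_norm_mul _ _
      _ ≤ ‖A‖ * ‖sampleMoment T f g - C‖ * ‖Bᵀ‖ := by
          gcongr
          exact Matrix.frobenius_norm_mul _ _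
      _ = ‖A‖ * ‖B‖ * ‖sampleMoment T f g - C‖ := by
          rw [Matrix.frobenius_norm_transpose, mul_right_comm]
  have hright : ‖sampleMoment T e g * Bᵀ‖ ≤ ‖B‖ * ‖sampleMoment T g e‖ := by
    rw [← sampleMoment_transpose T e g, Matrix.frobenius_norm_transpose, mul_comm ‖B‖,
      ← Matrix.frobenius_norm_transpose B]
    exact Matrix.frobenius_norm_mul _ _
  rw [hdecomp]
  refine (norm_add_four_sq_le _ _ _ _).trans ?_
  simp only [← mul_pow]
  gcongr
  exact Matrix.frobenius_norm_mul _ _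

end SampleMoment

section FactorModel

variable {Ω η : Type*} [Fintype η] [MeasurableSpace Ω] {μ : Measure Ω} {f : Ω → η → ℝ}

theorem memLp_dotProduct (hf : ∀ k, MemLp (fun ω => f ω k) 2 μ) (a : η → ℝ) :
    MemLp (fun ω => a ⬝ᵥ f ω) 2 μ :=
  memLp_finsetSum _ fun k _ => (hf k).const_mul (a k)

variable [IsFiniteMeasure μ]

theorem covariance_dotProduct (hf : ∀ k, MemLp (fun ω => f ω k) 2 μ) (a b : η → ℝ) :
    cov[fun ω => a ⬝ᵥ f ω, fun ω => b ⬝ᵥ f ω; μ] =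
      a ⬝ᵥ (Matrix.of fun k l => cov[fun ω => f ω k, fun ω => f ω l; μ]) *ᵥ b := by
  simp only [dotProduct, Matrix.mulVec, Matrix.of_apply]
  rw [covariance_fun_sum_fun_sum (fun k => (hf k).const_mul _) (fun k => (hf k).const_mul _)]
  simp only [covariance_const_mul_left, covariance_const_mul_right, Finset.mul_sum]
  exact Finset.sum_congr rfl fun k _ => Finset.sum_congr rfl fun l _ => by ring

theorem covariance_dotProduct_add {e e' : Ω → ℝ} (hf : ∀ k, MemLp (fun ω => f ω k) 2 μ)
    (he : MemLp e 2 μ) (he' : MemLp e' 2 μ) (hfe : IndepFun f e μ) (hfe' : IndepFun f e' μ)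
    (hee' : cov[e, e'; μ] = 0) (a b : η → ℝ) :
    cov[fun ω => a ⬝ᵥ f ω + e ω, fun ω => b ⬝ᵥ f ω + e' ω; μ] =
      a ⬝ᵥ (Matrix.of fun k l => cov[fun ω => f ω k, fun ω => f ω l; μ]) *ᵥ b := by
  have ha := memLp_dotProduct hf a
  have hb := memLp_dotProduct hf b
  have hdot (c : η → ℝ) : Measurable fun x : η → ℝ => c ⬝ᵥ x := by
    unfold dotProduct
    fun_prop
  have hae' : cov[fun ω => a ⬝ᵥ f ω, e'; μ] = 0 :=
    (hfe'.comp (hdot a) measurable_id).covariance_eq_zero ha he'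
  have heb : cov[e, fun ω => b ⬝ᵥ f ω; μ] = 0 :=
    (hfe.symm.comp measurable_id (hdot b)).covariance_eq_zero he hb
  change cov[(fun ω => a ⬝ᵥ f ω) + e, (fun ω => b ⬝ᵥ f ω) + e'; μ] = _
  rw [covariance_add_left ha he (hb.add he'), covariance_add_right ha hb he',
    covariance_add_right he hb he', hae', heb, hee', covariance_dotProduct hf, add_zero, add_zero,
    add_zero]

end FactorModel

theorem sum_mul_transpose_eq_unfoldRows {ι κ η : Type*} [Fintype κ] [Fintype η]
    (O : η → η → Matrix ι κ ℝ) :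
    ∑ i, ∑ j, O i j * (O i j)ᵀ =
      unfoldRows (Matrix.of fun (x : ι × η) (y : κ × η) => O x.2 y.2 x.1 y.1) *
        (unfoldRows (Matrix.of fun (x : ι × η) (y : κ × η) => O x.2 y.2 x.1 y.1))ᵀ := by
  ext u u'
  simp only [Matrix.sum_apply, Matrix.mul_apply, Matrix.transpose_apply, unfoldRows,
    Matrix.of_apply, Fintype.sum_prod_type]
  exact Finset.sum_congr rfl fun i _ => Finset.sum_comm

namespace Model

open scoped Kronecker

variable {Ω : Type*} {d r : ℕ} {𝒮 : Set (EuclideanSpace ℝ (Fin 2))}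

/-- `vec X_t`. -/
def factorVec (m : Model Ω d r 𝒮) (ω : Ω) (t : ℕ) : Fin d × Fin r → ℝ :=
  fun k => m.X t ω k.1 k.2

/-- The errors `ε_t(s)` at the sites `s ∈ S`, stacked into one vector. -/
def noiseVec (m : Model Ω d r 𝒮) (N : ℕ) (S : Finset 𝒮) (ω : Ω) (t : ℕ) :
    S × Fin (m.p N) → ℝ :=
  fun x => m.ε N t ω x.1 x.2

/-- The observations `y_t(s)` at the sites `s ∈ S`, stacked into one vector. -/
def obsVec (m : Model Ω d r 𝒮) (N : ℕ) (S : Finset 𝒮) (ω : Ω) (t : ℕ) :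
    S × Fin (m.p N) → ℝ :=
  fun x => m.y N t ω x.1 x.2

/-- The loading matrix `A ⊗ B` of the vectorized model at the sites of `S`. -/
def loading (m : Model Ω d r 𝒮) (N : ℕ) (S : Finset 𝒮) :
    Matrix (S × Fin (m.p N)) (Fin d × Fin r) ℝ :=
  (Matrix.of fun s : S => m.a s) ⊗ₖ m.B N

/-- The sample cross-covariance of the vectorized observations, whose blocks are the `Ω̂_{ij}`. -/
def sampleCross (m : Model Ω d r 𝒮) (N : ℕ) (ω : Ω) :
    Matrix (m.S₁ N × Fin (m.p N)) (m.S₂ N × Fin (m.p N)) ℝ :=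
  sampleMoment (m.T N) (m.obsVec N (m.S₁ N) ω) (m.obsVec N (m.S₂ N) ω)

/-- The cross-covariance of the vectorized observations, whose blocks are the `Ω_{ij}`
(see `popOmega_apply`). -/
def popCross [MeasurableSpace Ω] (m : Model Ω d r 𝒮) (μ : Measure Ω) (N : ℕ) :
    Matrix (m.S₁ N × Fin (m.p N)) (m.S₂ N × Fin (m.p N)) ℝ :=
  m.loading N (m.S₁ N) * m.factorCov μ * (m.loading N (m.S₂ N))ᵀ

variable {m : Model Ω d r 𝒮} {q : ℝ}

theorem y_apply (N : ℕ) (t : ℤ) (ω : Ω) (s : 𝒮) (i : Fin (m.p N)) :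
    m.y N t ω s i =
      (fun k : Fin d × Fin r => m.a s k.1 * m.B N i k.2) ⬝ᵥ (fun k => m.X t ω k.1 k.2) +
        m.ε N t ω s i := by
  simp only [y, Pi.add_apply, Matrix.mulVec, dotProduct, Matrix.mul_apply, Matrix.transpose_apply,
    Finset.sum_mul, Fintype.sum_prod_type]
  congr! 3
  ring

theorem obsVec_eq (N : ℕ) (S : Finset 𝒮) (ω : Ω) (t : ℕ) :
    m.obsVec N S ω t = m.loading N S *ᵥ m.factorVec ω t + m.noiseVec N S ω t :=
  funext fun _ => y_apply ..

theorem sampleM₁_eq (N : ℕ) (ω : Ω) :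
    m.sampleM₁ N ω = unfoldRows (m.sampleCross N ω) * (unfoldRows (m.sampleCross N ω))ᵀ := by
  have hblocks : (Matrix.of fun (x : m.S₁ N × Fin (m.p N)) (y : m.S₂ N × Fin (m.p N)) =>
      m.sampleOmega N ω x.2 y.2 x.1 y.1) = m.sampleCross N ω := by
    ext x y
    simp only [Matrix.of_apply, sampleOmega, sampleCross, sampleMoment, Matrix.smul_apply,
      Matrix.sum_apply, Matrix.vecMulVec_apply, obsVec]
  rw [sampleM₁, sum_mul_transpose_eq_unfoldRows, hblocks]

variable [MeasurableSpace Ω] {μ : Measure Ω}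

theorem unfoldRows_popCross (N : ℕ) :
    unfoldRows (m.popCross μ N) =
      m.A₁ N * (unfoldRows (m.factorCov μ) * (m.B N ⊗ₖ m.loading N (m.S₂ N))ᵀ) :=
  unfoldRows_kronecker_mul ..

theorem MixingCondition.covariance_factor (hmix : m.MixingCondition μ q) (k l : Fin d × Fin r) :
    cov[fun ω => m.X 0 ω k.1 k.2, fun ω => m.X 0 ω l.1 l.2; μ] = m.factorCov μ k l := by
  simp [covariance, hmix.mean_zero, factorCov]

theorem exists_outerMeanLE_sq_norm_noise_noise (hnoise : m.NuggetNoise μ) (hdesign : m.Design) :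
    ∃ K : ℝ, ∀ N T : ℕ, OuterMeanLE μ
      (fun ω => ‖sampleMoment T (m.noiseVec N (m.S₁ N) ω) (m.noiseVec N (m.S₂ N) ω)‖ ^ 2)
      (m.n₁ N * m.p N * (m.n₂ N * m.p N) * (K / T)) := by
  obtain ⟨K, hK⟩ := exists_outerMeanLE_sq_average_noise_mul_noise hnoise hdesign
  refine ⟨K, fun N T => ?_⟩
  refine (OuterMeanLE.frobenius_norm_sq (c := fun _ _ => K / T) fun x y => ?_).mono
    (fun _ => le_rfl) (le_of_eq ?_)
  · simpa only [sampleMoment_apply, noiseVec] using hK N x.1 y.1 x.2 y.2 T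
  · simp only [Finset.sum_const, Finset.card_univ, Fintype.card_prod, Fintype.card_fin,
      Fintype.card_coe, nsmul_eq_mul, Nat.cast_mul, n₁, n₂, mul_assoc]

variable [IsProbabilityMeasure μ]

theorem popOmega_apply (hmix : m.MixingCondition μ q) (hmom : m.BoundedMoments μ q)
    (hnoise : m.NuggetNoise μ) (hdesign : m.Design) {N : ℕ} (i j : Fin (m.p N)) (u : m.S₁ N)
    (v : m.S₂ N) : m.popOmega μ N i j u v = m.popCross μ N (u, i) (v, j) := by
  have hindep (s : 𝒮) (i : Fin (m.p N)) :
      IndepFun (fun ω (k : Fin d × Fin r) => m.X 0 ω k.1 k.2) (fun ω => m.ε N 0 ω s i) μ :=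
    (hnoise.indep_factor N).comp (φ := fun x : ℤ → Fin d × Fin r → ℝ => x 0)
      (ψ := fun x : ℤ → 𝒮 × Fin (m.p N) → ℝ => x 0 (s, i)) (by fun_prop) (by fun_prop)
  simp only [popOmega, Matrix.of_apply, y_apply]
  rw [covariance_dotProduct_add (hmix.memLp_factor hmom 0) (hnoise.memLp ..) (hnoise.memLp ..)
    (hindep u i) (hindep v j) (hnoise.uncorrelated N 0 u v (hdesign.ne_of_mem u v) i j)]
  simp only [hmix.covariance_factor]
  rw [popCross, Matrix.mul_assoc]
  rfl

theorem popM₁_eq (hmix : m.MixingCondition μ q) (hmom : m.BoundedMoments μ q)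
    (hnoise : m.NuggetNoise μ) (hdesign : m.Design) (N : ℕ) :
    m.popM₁ μ N = unfoldRows (m.popCross μ N) * (unfoldRows (m.popCross μ N))ᵀ := by
  have hblocks : (Matrix.of fun (x : m.S₁ N × Fin (m.p N)) (y : m.S₂ N × Fin (m.p N)) =>
      m.popOmega μ N x.2 y.2 x.1 y.1) = m.popCross μ N := by
    ext x y
    exact popOmega_apply hmix hmom hnoise hdesign ..
  rw [popM₁, sum_mul_transpose_eq_unfoldRows, hblocks]

theorem exists_expandsBy_unfoldRows_factorCov (hmix : m.MixingCondition μ q)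
    (hmom : m.BoundedMoments μ q) (hnoise : m.NuggetNoise μ) (hdesign : m.Design)
    (hid : ∃ N, (m.popM₁ μ N).rank = d) :
    ∃ c > 0, ExpandsBy c (unfoldRows (m.factorCov μ))ᵀ := by
  obtain ⟨N, hN⟩ := hid
  rw [popM₁_eq hmix hmom hnoise hdesign, Matrix.rank_self_mul_transpose, unfoldRows_popCross]
    at hN
  exact exists_expandsBy_of_injective <| transpose_mulVec_injective_of_le_rank <|
    hN.symm.le.trans <| (Matrix.rank_mul_le_right _ _).trans (Matrix.rank_mul_le_left _ _)

theorem exists_outerMeanLE_sq_norm_factorError (hmix : m.MixingCondition μ q)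
    (hmom : m.BoundedMoments μ q) :
    ∃ K : ℝ, ∀ T : ℕ, 0 < T → OuterMeanLE μ
      (fun ω => ‖sampleMoment T (m.factorVec ω) (m.factorVec ω) - m.factorCov μ‖ ^ 2)
      (K / T) := by
  obtain ⟨K, hK⟩ := exists_outerMeanLE_sq_average_factor_mul_factor hmix hmom
  refine ⟨d * r * (d * r * K), fun T hT => ?_⟩
  refine (OuterMeanLE.frobenius_norm_sq (c := fun _ _ => K / T) fun k l => ?_).mono
    (fun _ => le_rfl) (le_of_eq ?_)
  · simpa only [sampleMoment_sub_apply hT, factorVec] using hK k l T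
  · simp only [Finset.sum_const, Finset.card_univ, Fintype.card_prod, Fintype.card_fin,
      nsmul_eq_mul, Nat.cast_mul]
    ring

theorem exists_outerMeanLE_sq_norm_factor_noise (hmix : m.MixingCondition μ q)
    (hmom : m.BoundedMoments μ q) (hnoise : m.NuggetNoise μ) :
    ∃ K : ℝ, ∀ (N : ℕ) (S : Finset 𝒮), S = m.S₁ N ∨ S = m.S₂ N → ∀ T : ℕ, OuterMeanLE μ
      (fun ω => ‖sampleMoment T (m.factorVec ω) (m.noiseVec N S ω)‖ ^ 2)
      (S.card * m.p N * (K / T)) := by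
  obtain ⟨K, hK⟩ := exists_outerMeanLE_sq_average_factor_mul_noise hmix hmom hnoise
  refine ⟨(m.factorCov μ).trace * K, fun N S hS T => ?_⟩
  refine (OuterMeanLE.frobenius_norm_sq (c := fun k _ => m.factorCov μ k k * K / T)
    fun k x => ?_).mono (fun _ => le_rfl) (le_of_eq ?_)
  · have hx : (x.1 : 𝒮) ∈ (m.S₁ N : Set 𝒮) ∪ m.S₂ N := by
      rcases hS with rfl | rfl
      exacts [Or.inl x.1.2, Or.inr x.1.2]
    simpa only [sampleMoment_apply, factorVec, noiseVec] using hK N k x.1 hx x.2 T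
  · simp only [Finset.sum_const, Finset.card_univ, Fintype.card_prod, Fintype.card_fin,
      Fintype.card_coe, nsmul_eq_mul, Nat.cast_mul, Matrix.trace, Matrix.diag, ← Finset.mul_sum,
      ← Finset.sum_div, ← Finset.sum_mul]

theorem exists_outerMeanLE_sq_norm_cross_error (hmix : m.MixingCondition μ q)
    (hmom : m.BoundedMoments μ q) (hnoise : m.NuggetNoise μ) (hdesign : m.Design) :
    ∃ K : ℝ, ∀ N, 0 < m.T N → OuterMeanLE μ
      (fun ω => ‖m.sampleCross N ω - m.popCross μ N‖ ^ 2)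
      (K * ((‖m.loading N (m.S₁ N)‖ ^ 2 + m.n₁ N * m.p N) *
        (‖m.loading N (m.S₂ N)‖ ^ 2 + m.n₂ N * m.p N) / m.T N)) := by
  obtain ⟨K₁, hfactor⟩ := exists_outerMeanLE_sq_norm_factorError hmix hmom
  obtain ⟨K₂, hmixed⟩ := exists_outerMeanLE_sq_norm_factor_noise hmix hmom hnoise
  obtain ⟨K₃, hnoisy⟩ := exists_outerMeanLE_sq_norm_noise_noise hnoise hdesign
  refine ⟨4 * max K₁ (max K₂ K₃), fun N hT => ?_⟩
  have hK₁ : K₁ ≤ max K₁ (max K₂ K₃) := le_max_left _ _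
  have hK₂ : K₂ ≤ max K₁ (max K₂ K₃) := (le_max_left _ _).trans (le_max_right _ _)
  have hK₃ : K₃ ≤ max K₁ (max K₂ K₃) := (le_max_right _ _).trans (le_max_right _ _)
  set K := max K₁ (max K₂ K₃)
  set L₁ := m.loading N (m.S₁ N)
  set L₂ := m.loading N (m.S₂ N)
  have hbound := (((((hfactor (m.T N) hT).const_mul (c := ‖L₁‖ ^ 2 * ‖L₂‖ ^ 2)
    (by positivity)).add ((hmixed N (m.S₂ N) (Or.inr rfl) (m.T N)).const_mul (c := ‖L₁‖ ^ 2)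
    (by positivity))).add ((hmixed N (m.S₁ N) (Or.inl rfl) (m.T N)).const_mul (c := ‖L₂‖ ^ 2)
    (by positivity))).add (hnoisy N (m.T N))).const_mul (c := 4) (by positivity)
  refine hbound.mono (fun ω => ?_) ?_
  · have hobs (S : Finset 𝒮) : m.obsVec N S ω =
        fun t => m.loading N S *ᵥ m.factorVec ω t + m.noiseVec N S ω t :=
      funext (obsVec_eq N S ω)
    rw [sampleCross, hobs, hobs]
    exact norm_sampleMoment_mulVec_add_sub_sq_le ..
  · calc
      _ ≤ 4 * (‖L₁‖ ^ 2 * ‖L₂‖ ^ 2 * (K / m.T N) +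
            ‖L₁‖ ^ 2 * ((m.S₂ N).card * m.p N * (K / m.T N)) +
            ‖L₂‖ ^ 2 * ((m.S₁ N).card * m.p N * (K / m.T N)) +
            m.n₁ N * m.p N * (m.n₂ N * m.p N) * (K / m.T N)) := by
          gcongr
      _ = _ := by
          rw [n₁, n₂]
          ring

end Model

/-! ### Rates of convergence -/

section Rates

variable {α : Type*} {l : Filter α} {ι : α → Type*} {κ : Type*} [∀ N, Fintype (ι N)] [Fintype κ]
  {A : ∀ N, Matrix (ι N) κ ℝ} {g : α → ℝ}

theorem isBigO_frobenius_norm_sq (h : (fun N => specNormSq (A N)) =O[l] g) :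
    (fun N => ‖A N‖ ^ 2) =O[l] g := by
  refine IsBigO.trans (.of_bound (Fintype.card κ) (.of_forall fun N => ?_)) h
  rw [Real.norm_of_nonneg (by positivity)]
  exact (frobenius_norm_sq_le_card_mul_specNormSq (A N)).trans
    (mul_le_mul_of_nonneg_left (le_abs_self _) (by positivity))

theorem eventually_minNormSq_pos (h : (fun N => minNormSq (A N)) =Θ[l] g)
    (hg : ∀ᶠ N in l, 0 < g N) : ∀ᶠ N in l, 0 < minNormSq (A N) := by
  filter_upwards [h.eq_zero_iff, hg] with N hzero hpos
  exact (minNormSq_nonneg _).lt_of_ne' (mt hzero.1 hpos.ne')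

theorem isBigO_rpow_one_sub {u : α → ℕ} (hu : ∀ᶠ N in l, 0 < u N) {δ : ℝ} (hδ : 0 ≤ δ) :
    (fun N => (u N : ℝ) ^ (1 - δ)) =O[l] fun N => (u N : ℝ) := by
  refine .of_bound' (hu.mono fun N hN => ?_)
  have hone : (1 : ℝ) ≤ u N := Nat.one_le_cast.2 hN
  rw [Real.norm_of_nonneg (by positivity), Real.norm_of_nonneg (by positivity)]
  exact (Real.rpow_le_rpow_of_exponent_le hone (sub_le_self _ hδ)).trans_eq (Real.rpow_one _)

end Rates

namespace Model

open scoped Kronecker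

variable {Ω : Type*} {d r : ℕ} {𝒮 : Set (EuclideanSpace ℝ (Fin 2))} {m : Model Ω d r 𝒮}
  {q δ γ : ℝ}

theorem Design.eventually_pos (hdesign : m.Design) (hd : 0 < d) :
    ∀ᶠ N in atTop, 0 < m.n₁ N ∧ 0 < m.n₂ N ∧ 0 < m.p N ∧ 0 < m.T N := by
  filter_upwards [hdesign.p_tendsto.eventually_gt_atTop 0,
    hdesign.T_tendsto.eventually_gt_atTop 0] with N hp hT
  exact ⟨hd.trans_le (hdesign.d_le_n₁ N), hd.trans_le (hdesign.d_le_n₂ N), hp, hT⟩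

theorem isBigO_norm_loading_sq (hB : m.VariableStrength γ) (hp : ∀ᶠ N in atTop, 0 < m.p N)
    {S : ℕ → Finset 𝒮} (hS : ∀ᶠ N in atTop, 0 < (S N).card) (hδ : 0 ≤ δ)
    (hA : (fun N => specNormSq (Matrix.of fun s : S N => m.a s)) =O[atTop]
      fun N => ((S N).card : ℝ) ^ (1 - δ)) :
    (fun N => ‖m.loading N (S N)‖ ^ 2) =O[atTop] fun N => ((S N).card : ℝ) * m.p N := by
  simp only [loading, frobenius_norm_kronecker, mul_pow]
  exact (isBigO_frobenius_norm_sq (hA.trans (isBigO_rpow_one_sub hS hδ))).mul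
    (isBigO_frobenius_norm_sq (hB.max.1.trans (isBigO_rpow_one_sub hp hB.mem.1)))

/-- The mean square rate `n₁^δ n₂^δ p^{2γ} T⁻¹`. -/
def sqRate (m : Model Ω d r 𝒮) (δ γ : ℝ) (N : ℕ) : ℝ :=
  (m.n₁ N : ℝ) ^ δ * (m.n₂ N : ℝ) ^ δ * (m.p N : ℝ) ^ (2 * γ) * (m.T N : ℝ)⁻¹

theorem sqRate_eq_div {N : ℕ} (hn₁ : 0 < m.n₁ N) (hn₂ : 0 < m.n₂ N) (hp : 0 < m.p N) :
    m.sqRate δ γ N = m.n₁ N * m.p N * (m.n₂ N * m.p N) / m.T N /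
      ((m.n₁ N : ℝ) ^ (1 - δ) * (m.n₂ N : ℝ) ^ (1 - δ) * ((m.p N : ℝ) ^ (1 - γ)) ^ 2) := by
  have hn₁' : (0 : ℝ) < m.n₁ N := Nat.cast_pos.2 hn₁
  have hn₂' : (0 : ℝ) < m.n₂ N := Nat.cast_pos.2 hn₂
  have hp' : (0 : ℝ) < m.p N := Nat.cast_pos.2 hp
  rw [sqRate, mul_comm 2 γ, Real.rpow_mul hp'.le, Real.rpow_two,
    Real.rpow_sub hn₁', Real.rpow_sub hn₂', Real.rpow_sub hp']
  simp only [Real.rpow_one]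
  field_simp

theorem isBigO_norm_loading_sq_add_mul (hdesign : m.Design) (hd : 0 < d)
    (hA : m.SpatialStrength δ) (hB : m.VariableStrength γ) :
    (fun N => (‖m.loading N (m.S₁ N)‖ ^ 2 + m.n₁ N * m.p N) *
      (‖m.loading N (m.S₂ N)‖ ^ 2 + m.n₂ N * m.p N) / m.T N) =O[atTop]
        fun N => (m.n₁ N * m.p N * (m.n₂ N * m.p N) / m.T N : ℝ) := by
  have hpos := hdesign.eventually_pos hd
  have hp : ∀ᶠ N in atTop, 0 < m.p N := hpos.mono fun _ h => h.2.2.1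
  have h₁ := isBigO_norm_loading_sq hB hp (hpos.mono fun _ h => h.1) hA.mem.1 hA.max₁.1
  have h₂ := isBigO_norm_loading_sq hB hp (hpos.mono fun _ h => h.2.1) hA.mem.1 hA.max₂.1
  simp only [div_eq_mul_inv]
  exact ((h₁.add (isBigO_refl _ _)).mul (h₂.add (isBigO_refl _ _))).mul (isBigO_refl _ _)

/-- A lower bound, up to a positive constant, for the positive eigenvalues of `M₁`. -/
def signalStrength (m : Model Ω d r 𝒮) (N : ℕ) : ℝ :=
  minNormSq (m.A₁ N) * minNormSq (m.A₂ N) * minNormSq (m.B N) ^ 2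

theorem eventually_sqRate_le_rate_sq (hdesign : m.Design) (hd : 0 < d) :
    ∀ᶠ N in atTop, 0 < m.rate δ γ N ∧ m.sqRate δ γ N ≤ m.rate δ γ N ^ 2 := by
  filter_upwards [hdesign.eventually_pos hd] with N ⟨hn₁, hn₂, hp, hT⟩
  refine ⟨Real.sqrt_pos.2 (by positivity), ?_⟩
  rw [rate, Real.sq_sqrt (by positivity), sqRate]
  gcongr
  exact le_add_of_nonneg_left (by positivity)

theorem balancedRate_sq (N : ℕ) :
    m.balancedRate δ γ N ^ 2 =
      (m.n N : ℝ) ^ δ * (m.n N : ℝ) ^ δ * (m.p N : ℝ) ^ (2 * γ) * (m.T N : ℝ)⁻¹ := by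
  have hT : ((m.T N : ℝ) ^ (-(1 / 2) : ℝ)) ^ 2 = (m.T N : ℝ)⁻¹ := by
    rw [← Real.rpow_mul_natCast (Nat.cast_nonneg _), ← Real.rpow_neg_one]
    norm_num
  rw [balancedRate, mul_pow, mul_pow, hT, ← sq, mul_comm 2 γ, Real.rpow_mul (Nat.cast_nonneg _),
    Real.rpow_two]

theorem eventually_sqRate_le_balancedRate_sq (hdesign : m.Design) (hd : 0 < d) (hδ : 0 ≤ δ) :
    ∀ᶠ N in atTop, 0 < m.balancedRate δ γ N ∧ m.sqRate δ γ N ≤ m.balancedRate δ γ N ^ 2 := by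
  filter_upwards [hdesign.eventually_pos hd] with N ⟨hn₁, hn₂, hp, hT⟩
  have hn : 0 < m.n N := Nat.add_pos_left hn₁ _
  refine ⟨by unfold balancedRate; positivity, ?_⟩
  rw [balancedRate_sq, sqRate]
  gcongr
  exacts [Nat.le_add_right _ _, Nat.le_add_left _ _]

theorem signalStrength_isTheta (hA : m.SpatialStrength δ) (hB : m.VariableStrength γ) :
    m.signalStrength =Θ[atTop] fun N =>
      (m.n₁ N : ℝ) ^ (1 - δ) * (m.n₂ N : ℝ) ^ (1 - δ) * ((m.p N : ℝ) ^ (1 - γ)) ^ 2 :=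
  (hA.min₁.mul hA.min₂).mul (hB.min.pow 2)

theorem cross_error_div_signalStrength_isBigO (hdesign : m.Design) (hd : 0 < d)
    (hA : m.SpatialStrength δ) (hB : m.VariableStrength γ) :
    (fun N => (‖m.loading N (m.S₁ N)‖ ^ 2 + m.n₁ N * m.p N) *
      (‖m.loading N (m.S₂ N)‖ ^ 2 + m.n₂ N * m.p N) / m.T N / m.signalStrength N) =O[atTop]
        m.sqRate δ γ := by
  have hdiv := (isBigO_norm_loading_sq_add_mul hdesign hd hA hB).mul
    (signalStrength_isTheta hA hB).inv.1
  simp only [← div_eq_mul_inv] at hdiv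
  refine hdiv.trans (EventuallyEq.isBigO ?_)
  filter_upwards [hdesign.eventually_pos hd] with N ⟨hn₁, hn₂, hp, _⟩
  exact (sqRate_eq_div hn₁ hn₂ hp).symm

variable [MeasurableSpace Ω] {μ : Measure Ω}

theorem mul_spaceDist_sq_le_norm_cross_error (hdesign : m.Design) (hd : 0 < d) {c : ℝ}
    (hc : 0 < c) (hfactor : ExpandsBy c (unfoldRows (m.factorCov μ))ᵀ) {N : ℕ} (hr : r ≤ m.p N)
    (hA₁ : 0 < minNormSq (m.A₁ N)) {ω : Ω} {U : Matrix (m.S₁ N) (Fin d) ℝ}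
    (hU : IsLeadingEigenvectors (m.sampleM₁ N ω) U) :
    c * m.signalStrength N * spaceDist U (m.A₁ N) ^ 2 ≤
      4 * ‖m.sampleCross N ω - m.popCross μ N‖ ^ 2 := by
  have hexpA₁ : ExpandsBy (minNormSq (m.A₁ N)) (m.A₁ N) := expandsBy_minNormSq _ <| by
    simpa only [Fintype.card_fin, Fintype.card_coe, n₁] using hdesign.d_le_n₁ N
  have hexpA₂ : ExpandsBy (minNormSq (m.A₂ N)) (m.A₂ N) := expandsBy_minNormSq _ <| by
    simpa only [Fintype.card_fin, Fintype.card_coe, n₂] using hdesign.d_le_n₂ N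
  have hexpB : ExpandsBy (minNormSq (m.B N)) (m.B N) := expandsBy_minNormSq _ <| by
    simpa only [Fintype.card_fin] using hr
  have hB0 := minNormSq_nonneg (m.B N)
  have hA₂0 := minNormSq_nonneg (m.A₂ N)
  have hexpL₂ : ExpandsBy (minNormSq (m.A₂ N) * minNormSq (m.B N)) (m.loading N (m.S₂ N)) :=
    hexpA₂.kronecker hexpB hB0
  rw [sampleM₁_eq] at hU
  rw [← frobenius_norm_unfoldRows]
  have hperturb := mul_spaceDist_sq_le (hexpA₁.injective hA₁) hd hU
    (signal_lower_bound hexpA₁ hfactor (hexpB.kronecker hexpL₂ (by positivity)) hA₁.le hc.le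
      (by positivity))
  rw [← unfoldRows_popCross] at hperturb
  have hscale : c * m.signalStrength N =
      minNormSq (m.B N) * (minNormSq (m.A₂ N) * minNormSq (m.B N)) * c * minNormSq (m.A₁ N) := by
    rw [signalStrength]
    ring
  rw [hscale]
  exact hperturb

variable [IsProbabilityMeasure μ]

theorem isBigOp_spaceDist (hd : 0 < d) (hdesign : m.Design) (hnoise : m.NuggetNoise μ)
    (hid : ∃ N, (m.popM₁ μ N).rank = d) (hmix : m.MixingCondition μ q)
    (hmom : m.BoundedMoments μ q) (hA : m.SpatialStrength δ) (hB : m.VariableStrength γ)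
    {Ahat : (N : ℕ) → Ω → Matrix (m.S₁ N) (Fin d) ℝ}
    (hAhat : ∀ N ω, IsLeadingEigenvectors (m.sampleM₁ N ω) (Ahat N ω)) {ρ : ℕ → ℝ}
    (hρ : ∀ᶠ N in atTop, 0 < ρ N ∧ m.sqRate δ γ N ≤ ρ N ^ 2) :
    IsBigOp μ (fun N ω => spaceDist (Ahat N ω) (m.A₁ N)) ρ := by
  obtain ⟨c, hc, hfactor⟩ := exists_expandsBy_unfoldRows_factorCov hmix hmom hnoise hdesign hid
  obtain ⟨K, herror⟩ := exists_outerMeanLE_sq_norm_cross_error hmix hmom hnoise hdesign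
  have hpos := hdesign.eventually_pos hd
  have hA₁ := eventually_minNormSq_pos hA.min₁ (hpos.mono fun N h => by have := h.1; positivity)
  have hA₂ := eventually_minNormSq_pos hA.min₂ (hpos.mono fun N h => by have := h.2.1; positivity)
  have hB₀ := eventually_minNormSq_pos hB.min (hpos.mono fun N h => by have := h.2.2.1; positivity)
  have hsqRate : m.sqRate δ γ =O[atTop] fun N => ρ N ^ 2 := by
    refine .of_bound' (hρ.mono fun N h => ?_)
    rw [Real.norm_of_nonneg (by unfold sqRate; positivity), Real.norm_of_nonneg (sq_nonneg _)]
    exact h.2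
  refine isBigOp_of_outerMeanLE_sq ?_
    (((cross_error_div_signalStrength_isBigO hdesign hd hA hB).trans hsqRate).const_mul_left
      (4 / c * K)) (hρ.mono fun N h => h.1)
  filter_upwards [hpos, hdesign.p_tendsto.eventually_ge_atTop r, hA₁, hA₂, hB₀]
    with N ⟨_, _, _, hT⟩ hr hA₁ hA₂ hB₀
  have hsignal : 0 < m.signalStrength N := by unfold signalStrength; positivity
  refine ((herror N hT).const_mul (c := 4 / (c * m.signalStrength N)) (by positivity)).mono
    (fun ω => ?_) (le_of_eq ?_)
  · rw [div_mul_eq_mul_div, le_div_iff₀' (by positivity)]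
    exact mul_spaceDist_sq_le_norm_cross_error hdesign hd hc hfactor hr hA₁ (hAhat N ω)
  · field_simp

end Model

/-! ### Exchanging the two sets of sites -/

theorem sum_mul_transpose_of_eq_transpose {ι κ η : Type*} [Fintype ι] [Fintype η]
    {O : η → η → Matrix ι κ ℝ} {O' : η → η → Matrix κ ι ℝ} (h : ∀ i j, O' i j = (O j i)ᵀ) :
    ∑ i, ∑ j, O' i j * (O' i j)ᵀ = ∑ i, ∑ j, (O i j)ᵀ * O i j := by
  rw [Finset.sum_comm]
  simp only [h, Matrix.transpose_transpose]

namespace Model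

variable {Ω : Type*} {d r : ℕ} {𝒮 : Set (EuclideanSpace ℝ (Fin 2))} {m : Model Ω d r 𝒮}
  {q δ γ : ℝ}

/-- The model with the two sets of sites exchanged, which reduces the case `l = 2` to `l = 1`. -/
def swap (m : Model Ω d r 𝒮) : Model Ω d r 𝒮 :=
  { m with S₁ := m.S₂, S₂ := m.S₁ }

theorem Design.swap (h : m.Design) : m.swap.Design where
  disjoint N := (h.disjoint N).symm
  d_le_n₁ := h.d_le_n₂
  d_le_n₂ := h.d_le_n₁
  n_tendsto := h.n_tendsto.congr fun N => add_comm (m.n₁ N) (m.n₂ N)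
  p_tendsto := h.p_tendsto
  T_tendsto := h.T_tendsto

theorem SpatialStrength.swap (h : m.SpatialStrength δ) : m.swap.SpatialStrength δ :=
  ⟨h.mem, h.min₂, h.max₂, h.min₁, h.max₁⟩

theorem VariableStrength.swap (h : m.VariableStrength γ) : m.swap.VariableStrength γ :=
  ⟨h.mem, h.min, h.max⟩

theorem sampleM₁_swap (N : ℕ) (ω : Ω) : m.swap.sampleM₁ N ω = m.sampleM₂ N ω := by
  refine sum_mul_transpose_of_eq_transpose (O := m.sampleOmega N ω) fun i j => ?_
  simp only [sampleOmega, Matrix.transpose_smul, Matrix.transpose_sum, Matrix.transpose_vecMulVec]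
  rfl

theorem sqRate_swap (N : ℕ) : m.swap.sqRate δ γ N = m.sqRate δ γ N := by
  unfold sqRate
  rw [mul_comm ((m.n₁ N : ℝ) ^ δ)]
  rfl

variable [MeasurableSpace Ω] {μ : Measure Ω}

theorem NuggetNoise.swap (h : m.NuggetNoise μ) : m.swap.NuggetNoise μ where
  measurable := h.measurable
  memLp := h.memLp
  mean_zero := h.mean_zero
  uncorrelated := h.uncorrelated
  indep_time := h.indep_time
  indep_factor := h.indep_factor
  bounded := by
    obtain ⟨K, hvar, hmixed⟩ := h.bounded
    refine ⟨K, fun N t u hu i => hvar N t u hu.symm i, fun N t u hu v hv i j => ?_⟩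
    simpa only [Model.swap, mul_comm] using hmixed N t v hv u hu j i

theorem MixingCondition.swap (h : m.MixingCondition μ q) : m.swap.MixingCondition μ q :=
  ⟨h.measurable, h.mean_zero, h.stationary, h.two_lt, h.mixing⟩

theorem popM₁_swap (N : ℕ) : m.swap.popM₁ μ N = m.popM₂ μ N :=
  sum_mul_transpose_of_eq_transpose (O := m.popOmega μ N) fun _ _ =>
    Matrix.ext fun _ _ => covariance_comm _ _

theorem isBigOp_spaceDist_swap [IsProbabilityMeasure μ] (hd : 0 < d) (hdesign : m.Design)
    (hnoise : m.NuggetNoise μ) (hid : ∃ N, (m.popM₂ μ N).rank = d)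
    (hmix : m.MixingCondition μ q) (hmom : m.BoundedMoments μ q) (hA : m.SpatialStrength δ)
    (hB : m.VariableStrength γ) {Ahat : (N : ℕ) → Ω → Matrix (m.S₂ N) (Fin d) ℝ}
    (hAhat : ∀ N ω, IsLeadingEigenvectors (m.sampleM₂ N ω) (Ahat N ω)) {ρ : ℕ → ℝ}
    (hρ : ∀ᶠ N in atTop, 0 < ρ N ∧ m.sqRate δ γ N ≤ ρ N ^ 2) :
    IsBigOp μ (fun N ω => spaceDist (Ahat N ω) (m.A₂ N)) ρ := by
  refine isBigOp_spaceDist (m := m.swap) hd hdesign.swap hnoise.swap ?_ hmix.swap hmom hA.swap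
    hB.swap (fun N ω => ?_) ?_
  · exact hid.imp fun N hN => (congrArg Matrix.rank (popM₁_swap N)).trans hN
  · exact (sampleM₁_swap (m := m) N ω).symm ▸ hAhat N ω
  · simpa only [sqRate_swap] using hρ

end Model

end SpatialFactor

end

open SpatialFactor in
theorem mainTheorem1_general {Ω : Type*} [MeasurableSpace Ω] (μ : Measure Ω)
    [IsProbabilityMeasure μ] {d r : ℕ} (hd : 0 < d) {𝒮 : Set (EuclideanSpace ℝ (Fin 2))}
    (m : Model Ω d r 𝒮) (q δ γ : ℝ) (hdesign : m.Design) (hnoise : m.NuggetNoise μ)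
    (hid₁ : ∃ N, (m.popM₁ μ N).rank = d) (hid₂ : ∃ N, (m.popM₂ μ N).rank = d)
    (hmix : m.MixingCondition μ q) (hmom : m.BoundedMoments μ q)
    (hA : m.SpatialStrength δ) (hB : m.VariableStrength γ)
    (Ahat₁ : (N : ℕ) → Ω → Matrix (m.S₁ N) (Fin d) ℝ)
    (Ahat₂ : (N : ℕ) → Ω → Matrix (m.S₂ N) (Fin d) ℝ)
    (hAhat₁ : ∀ N ω, IsLeadingEigenvectors (m.sampleM₁ N ω) (Ahat₁ N ω))
    (hAhat₂ : ∀ N ω, IsLeadingEigenvectors (m.sampleM₂ N ω) (Ahat₂ N ω)) :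
    (IsBigOp μ (fun N ω => spaceDist (Ahat₁ N ω) (m.A₁ N)) (m.rate δ γ) ∧
      IsBigOp μ (fun N ω => spaceDist (Ahat₂ N ω) (m.A₂ N)) (m.rate δ γ)) ∧
    IsBigOp μ (fun N ω => spaceDist (Ahat₁ N ω) (m.A₁ N)) (m.balancedRate δ γ) ∧
      IsBigOp μ (fun N ω => spaceDist (Ahat₂ N ω) (m.A₂ N)) (m.balancedRate δ γ) := by
  have hrate := Model.eventually_sqRate_le_rate_sq (m := m) (δ := δ) (γ := γ) hdesign hd
  have hbalanced :=
    Model.eventually_sqRate_le_balancedRate_sq (m := m) (γ := γ) hdesign hd hA.mem.1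
  have hdist₁ {ρ : ℕ → ℝ} (hρ : ∀ᶠ N in atTop, 0 < ρ N ∧ m.sqRate δ γ N ≤ ρ N ^ 2) :=
    Model.isBigOp_spaceDist hd hdesign hnoise hid₁ hmix hmom hA hB hAhat₁ hρ
  have hdist₂ {ρ : ℕ → ℝ} (hρ : ∀ᶠ N in atTop, 0 < ρ N ∧ m.sqRate δ γ N ≤ ρ N ^ 2) :=
    Model.isBigOp_spaceDist_swap hd hdesign hnoise hid₂ hmix hmom hA hB hAhat₂ hρ
  exact ⟨⟨hdist₁ hrate, hdist₂ hrate⟩, hdist₁ hbalanced, hdist₂ hbalanced⟩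

theorem mainTheorem1 {Ω : Type*} [MeasurableSpace Ω] (μ : Measure Ω) [IsProbabilityMeasure μ]
    {d r : ℕ} (hd : 0 < d) (hr : 0 < r) {𝒮 : Set (EuclideanSpace ℝ (Fin 2))}
    (m : SpatialFactor.Model Ω d r 𝒮) (q δ γ : ℝ)
    (hdesign : m.Design) (hnoise : m.NuggetNoise μ) (hid : m.Identified μ)
    (hmix : m.MixingCondition μ q) (hmom : m.MomentRankCondition μ q)
    (hA : m.SpatialStrength δ) (hB : m.VariableStrength γ)
    (hrate : Tendsto (m.balancedRate δ γ) atTop (𝓝 0))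
    (Ahat₁ : (N : ℕ) → Ω → Matrix (m.S₁ N) (Fin d) ℝ)
    (Ahat₂ : (N : ℕ) → Ω → Matrix (m.S₂ N) (Fin d) ℝ)
    (hAhat₁ : ∀ N ω, SpatialFactor.IsLeadingEigenvectors (m.sampleM₁ N ω) (Ahat₁ N ω))
    (hAhat₂ : ∀ N ω, SpatialFactor.IsLeadingEigenvectors (m.sampleM₂ N ω) (Ahat₂ N ω)) :
    (SpatialFactor.IsBigOp μ (fun N ω => SpatialFactor.spaceDist (Ahat₁ N ω) (m.A₁ N))
        (m.rate δ γ) ∧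
      SpatialFactor.IsBigOp μ (fun N ω => SpatialFactor.spaceDist (Ahat₂ N ω) (m.A₂ N))
        (m.rate δ γ)) ∧
    ((fun N => (m.n₁ N : ℝ)) =Θ[atTop] (fun N => (m.n N : ℝ)) →
      (fun N => (m.n₂ N : ℝ)) =Θ[atTop] (fun N => (m.n N : ℝ)) →
      SpatialFactor.IsBigOp μ (fun N ω => SpatialFactor.spaceDist (Ahat₁ N ω) (m.A₁ N))
        (m.balancedRate δ γ) ∧
      SpatialFactor.IsBigOp μ (fun N ω => SpatialFactor.spaceDist (Ahat₂ N ω) (m.A₂ N))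
        (m.balancedRate δ γ)) := by
  obtain ⟨N, hid₁, hid₂⟩ := hid.exists
  have hgeneral := mainTheorem1_general μ hd m q δ γ hdesign hnoise ⟨N, hid₁⟩ ⟨N, hid₂⟩ hmix
    hmom.moments hA hB Ahat₁ Ahat₂ hAhat₁ hAhat₂
  exact ⟨hgeneral.1, fun _ _ => hgeneral.2⟩
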